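/- **Theorem 1.3.** Let $P$ be a poset on $\{1,\dots,n\}$ with order $\le_P$ that is naturally labeled, i.e. $i<_P j$ implies $i<j$. A $P$-partition is a map $f:\{1,\dots,n\}\to\mathbb N=\{0,1,2,\dots\}$ such that $i<_P j$ implies $f(i)\ge f(j)$, with $f(i)>f(j)$ if moreover $i>j$. Let $$F_P(\mathbf x)=\sum_{f}x_1^{f(1)}\cdots x_n^{f(n)},$$ a formal power series, where the sum is over all $P$-partitions $f$. Let $G_P$ be the simple graph whose vertices are the (non-empty) connected order ideals of $P$, i.e. the order ideals whose Hasse diagram is a connected graph, two of them being adjacent iff they have non-empty intersection and neither contains the other. Let $C_1,\dots,C_h$ be the connected components of $G_P$, and for a graph $G$ let $\mathscr M(G)$ be the set of its maximum independent sets (independent sets of largest size). For $M\in\mathscr M(G_P)$ and $J\in M$ put $\mu(M,J)=\bigcup_{J'\in M,\,J'\subsetneq J}J'$. Let $F_M$ be the order on $\{1,\dots,n\}$ in which $i<_{F_M}j$ iff there are $J_a\subsetneq J_b$ in $M$ with $J_a\setminus\mu(M,J_a)=\{i\}$ and $J_b\setminus\mu(M,J_b)=\{j\}$, and let $\mathrm{Des}(M)$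 be the set of all $i$ that are covered in $F_M$ by some $j$ with $i>j$. For $M_r\in\mathscr M(C_r)$ and $M\in\mathscr M(G_P)$ with $M\cap V(C_r)=M_r$, let $$\overline{\mathrm{Des}}(M_r,M)=\{J\in M_r \mid J\setminus\mu(M,J)=\{i\}\text{ for some } i\in\mathrm{Des}(M)\}.$$ Then for every $r$ and every $M_r\in\mathscr M(C_r)$ such an $M$ exists and $\overline{\mathrm{Des}}(M_r,M)$ does not depend on its choice; and, writing $\overline{\mathrm{Des}}(M_r)$ for this set and $\mathbf x^J=\prod_{k\in J}x_k$, $$F_P(\mathbf x)=\prod_{r=1}^h\ \sum_{M_r\in\mathscr M(C_r)}\frac{\prod_{J\in\overline{\mathrm{Des}}(M_r)}\mathbf x^J}{\prod_{J\in M_r}(1-\mathbf x^J)} .$$ -/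

import Mathlib

/-! A poset `P` on the label set `{1, …, n}` is a partial order `P : PartialOrder (Fin n)`, passed
explicitly; the ambient order `<` on `Fin n` is the natural order of the labels. -/

namespace PPart

variable {n : ℕ}

/-- `P` is naturally labeled: `i <_P j` implies `i < j`. -/
def NaturallyLabeled (P : PartialOrder (Fin n)) : Prop :=
  ∀ i j : Fin n, P.lt i j → i < j

/-- `P`-partitions: `f` is weakly decreasing along `<_P`, and strictly decreasing along those
relations `i <_P j` for which `i > j` as labels. -/
def IsPPartition (P : PartialOrder (Fin n)) (f : Fin n → ℕ) : Prop :=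
  (∀ i j : Fin n, P.lt i j → f j ≤ f i) ∧
  (∀ i j : Fin n, P.lt i j → j < i → f j < f i)

open scoped Classical in
/-- `F_P(x) = ∑_f x^f` over all `P`-partitions `f`, as a formal power series: distinct `f` have
distinct monomials, so the coefficient of `x^f` is `1` if `f` is a `P`-partition and `0`
otherwise. -/
noncomputable def genFun (P : PartialOrder (Fin n)) : MvPowerSeries (Fin n) ℚ :=
  fun f : Fin n →₀ ℕ => if IsPPartition P f then 1 else 0

/-- Order ideals (down-closed subsets) of `P`. -/
def IsOrderIdeal (P : PartialOrder (Fin n)) (J : Finset (Fin n)) : Prop :=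
  ∀ i j : Fin n, i ∈ J → P.le j i → j ∈ J

/-- The Hasse diagram of the subposet of `P` on `J`. -/
def hasseDiagram (P : PartialOrder (Fin n)) (J : Finset (Fin n)) : SimpleGraph {i // i ∈ J} :=
  @SimpleGraph.hasse {i // i ∈ J} (@Subtype.preorder (Fin n) P.toPreorder (fun i => i ∈ J))

/-- The connected order ideals of `P`: those whose Hasse diagram is a connected graph
(in particular non-empty). -/
def ConnIdeal (P : PartialOrder (Fin n)) : Type :=
  {J : Finset (Fin n) // IsOrderIdeal P J ∧ (hasseDiagram P J).Connected}

instance (P : PartialOrder (Fin n)) : Finite (ConnIdeal P) :=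
  inferInstanceAs
    (Finite {J : Finset (Fin n) // IsOrderIdeal P J ∧ (hasseDiagram P J).Connected})

noncomputable instance (P : PartialOrder (Fin n)) : Fintype (ConnIdeal P) :=
  Fintype.ofFinite _

/-- The graph `G_P`: two connected order ideals are adjacent when they meet and neither contains
the other. -/
def graph (P : PartialOrder (Fin n)) : SimpleGraph (ConnIdeal P) where
  Adj A B := (A.1 ∩ B.1).Nonempty ∧ ¬ A.1 ⊆ B.1 ∧ ¬ B.1 ⊆ A.1
  symm := ⟨fun A B h => ⟨by rw [Finset.inter_comm]; exact h.1, h.2.2, h.2.1⟩⟩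
  loopless := ⟨fun A h => h.2.1 (Finset.Subset.refl A.1)⟩

noncomputable instance (P : PartialOrder (Fin n)) : Fintype (graph P).ConnectedComponent :=
  Fintype.ofFinite _

open scoped Classical in
/-- `μ(M, J)`: the union of all `J' ∈ M` properly contained in `J`. -/
noncomputable def mu {P : PartialOrder (Fin n)} (M : Finset (ConnIdeal P)) (J : ConnIdeal P) :
    Finset (Fin n) :=
  (M.filter (fun J' => J'.1 ⊂ J.1)).biUnion (fun J' => J'.1)

/-- The strict order of the forest `F_M` on the labels attached to a maximum independent set `M`:
`i <_{F_M} j` iff `J_a ⊂ J_b` for the members `J_a`, `J_b` of `M` with `J_a \ μ(M, J_a) = {i}` and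
`J_b \ μ(M, J_b) = {j}`. -/
def forestLT {P : PartialOrder (Fin n)} (M : Finset (ConnIdeal P)) (i j : Fin n) : Prop :=
  ∃ Ja ∈ M, ∃ Jb ∈ M, Ja.1 ⊂ Jb.1 ∧ Ja.1 \ mu M Ja = {i} ∧ Jb.1 \ mu M Jb = {j}

/-- `j` is the parent of `i` in `F_M`, that is, `j` covers `i` in `F_M`. -/
def IsParent {P : PartialOrder (Fin n)} (M : Finset (ConnIdeal P)) (j i : Fin n) : Prop :=
  forestLT M i j ∧ ¬ ∃ k, forestLT M i k ∧ forestLT M k j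

/-- `Des(M)`, the descent set of the forest `F_M`: the labels `i` that have a parent `j` in `F_M`
with `i > j`. -/
def Des {P : PartialOrder (Fin n)} (M : Finset (ConnIdeal P)) : Set (Fin n) :=
  {i | ∃ j, IsParent M j i ∧ j < i}

/-- `Des(M_r, M)`. -/
def DesRel {P : PartialOrder (Fin n)} (Mr M : Finset (ConnIdeal P)) : Set (Fin n) :=
  {i | i ∈ Des M ∧ ∃ J ∈ Mr, {i} = J.1 \ mu M J}

open scoped Classical in
/-- The set of ideals `J ∈ M_r` with `J \ μ(M, J) = {i}` for some `i ∈ Des(M_r, M)`. -/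
noncomputable def desBarRel {P : PartialOrder (Fin n)} (Mr M : Finset (ConnIdeal P)) :
    Finset (ConnIdeal P) :=
  Mr.filter (fun J => ∃ i ∈ DesRel Mr M, J.1 \ mu M J = {i})

open scoped Classical in
/-- The maximum independent sets of a connected component `C` of `G_P`, viewed as sets of vertices
of `G_P`. -/
noncomputable def compMaxIndepSets {P : PartialOrder (Fin n)}
    (C : (graph P).ConnectedComponent) : Finset (Finset (ConnIdeal P)) :=
  Finset.univ.filter (fun Mr => ∃ N : Finset C,
    C.toSimpleGraph.IsMaximumIndepSet N ∧ Mr = N.map (Function.Embedding.subtype _))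

/-- `M` is a maximum independent set of `G_P` with `M ∩ V(C) = M_r`. -/
def Extends {P : PartialOrder (Fin n)} (C : (graph P).ConnectedComponent)
    (Mr M : Finset (ConnIdeal P)) : Prop :=
  (graph P).IsMaximumIndepSet M ∧ (M : Set (ConnIdeal P)) ∩ C.supp = (Mr : Set (ConnIdeal P))

open scoped Classical in
/-- The descent ideals of `M_r`, computed from some maximum independent set `M` of `G_P` with
`M ∩ V(C) = M_r`. (If there were no such `M` the value would be `∅`.) -/
noncomputable def desBar {P : PartialOrder (Fin n)} (C : (graph P).ConnectedComponent)
    (Mr : Finset (ConnIdeal P)) : Finset (ConnIdeal P) :=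
  if h : ∃ M, Extends C Mr M then desBarRel Mr h.choose else ∅

/-- The monomial `x^J = ∏_{k ∈ J} x_k`. -/
noncomputable def mono {P : PartialOrder (Fin n)} (J : ConnIdeal P) : MvPowerSeries (Fin n) ℚ :=
  ∏ k ∈ J.1, MvPowerSeries.X k

/-- `1 - x^J` has constant coefficient `1`, so its inverse in the ring of power series is a genuine
one. -/
theorem one_sub_mono_mul_inv {P : PartialOrder (Fin n)} (J : ConnIdeal P) :
    (1 - mono J) * (1 - mono J)⁻¹ = 1 := by
  apply MvPowerSeries.mul_inv_cancel
  obtain ⟨⟨k, hk⟩⟩ := J.2.2.nonempty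
  have h : MvPowerSeries.constantCoeff (mono J) = 0 := by
    rw [mono, map_prod]
    exact Finset.prod_eq_zero hk (MvPowerSeries.constantCoeff_X k)
  simp [h]

end PPart

/-! Independent sets of $G_P$ are laminar families: two members are nested or disjoint.
Connectedness forces each member to contain an element lying in no smaller member, so there are at
most $n$ members, and a family with $n$ members is a forest with one label per ideal.

Given a $P$-partition $f$, let $\prec_f$ sort the labels by decreasing value of $f$, ties by label;
natural labeling makes it extend $<_P$. For each $j$ take the largest connected order ideal through
$j$ whose other elements all precede $j$. These $n$ ideals form an independent set, and it is the
only one with $n$ members whose forest has $\prec_f$ as a linear extension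
(`exists_unique_compatible`). So maximum independent sets have exactly $n$ members, and the
$P$-partitions are split into classes indexed by them.

The class of $M$ consists of the sums $f=\sum_{J\in M}b_J\mathbf 1_J$ with $b_J\ge 0$, and $b_J\ge
1$ at descents: $b_J$ is the drop of $f$ from the label of $J$ to that of its parent. The indicators
are linearly independent, so the class contributes $\prod_{\mathrm{Des}}\mathbf
x^J/\prod_{M}(1-\mathbf x^J)$ (`Labeled.coeff_term`, `genFun_eq_sum`).

Maximum independent sets of $G_P$ are free choices of one in each component, so the sum factors once
descents are known to be local (`Extends.desBarRel_subset`). This holds because the union of a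
component is an isolated vertex, hence lies in every maximum independent set and shields the
component from the rest, and because isolated vertices are never descents. -/

/-! ### Connectedness of the Hasse diagram through comparability -/

theorem SimpleGraph.hasse_reachable_of_le {α : Type*} [PartialOrder α] [Finite α] {a b : α}
    (h : a ≤ b) : (SimpleGraph.hasse α).Reachable a b := by
  classical
  have := Fintype.ofFinite α
  have : LocallyFiniteOrder α := Fintype.toLocallyFiniteOrder
  have h' := le_iff_reflTransGen_covBy.mp h
  induction h' with
  | refl => exact SimpleGraph.Reachable.refl _
  | @tail b c hab hbc ih =>
    exact (ih (le_iff_reflTransGen_covBy.mpr hab)).trans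
      (SimpleGraph.Adj.reachable (SimpleGraph.hasse_adj.mpr (Or.inl hbc)))

namespace PPart

variable {n : ℕ}

/-- A set is connected under the comparability relation of `P`: it is non-empty and has no proper
non-empty subset that is closed under comparability. -/
def CompConnected (P : PartialOrder (Fin n)) (J : Finset (Fin n)) : Prop :=
  J.Nonempty ∧ ∀ A ⊆ J, A.Nonempty →
    (∀ a ∈ A, ∀ b ∈ J, P.le a b ∨ P.le b a → b ∈ A) → J ⊆ A

theorem hasseDiagram_connected_iff (P : PartialOrder (Fin n)) (J : Finset (Fin n)) :
    (hasseDiagram P J).Connected ↔ CompConnected P J := by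
  classical
  let Q : PartialOrder {i // i ∈ J} := @Subtype.partialOrder (Fin n) P (fun i => i ∈ J)
  have hQ : hasseDiagram P J = @SimpleGraph.hasse _ Q.toPreorder := rfl
  rw [hQ]
  constructor
  · intro h
    refine ⟨by obtain ⟨x⟩ := h.nonempty; exact ⟨x.1, x.2⟩, ?_⟩
    rintro A hAJ ⟨a, ha⟩ hA b hb
    have hr := h.preconnected ⟨a, hAJ ha⟩ ⟨b, hb⟩
    rw [SimpleGraph.reachable_iff_reflTransGen] at hr
    suffices H : ∀ c, Relation.ReflTransGen (SimpleGraph.hasse {i // i ∈ J}).Adj ⟨a, hAJ ha⟩ c →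
        c.1 ∈ A from H _ hr
    intro c hc
    induction hc with
    | refl => exact ha
    | @tail b c _ hbc ih =>
      refine hA _ ih _ c.2 ?_
      rcases hbc with h | h
      · exact Or.inl h.le
      · exact Or.inr h.le
  · rintro ⟨⟨a, ha⟩, h⟩
    have key : ∀ b : {i // i ∈ J},
        (SimpleGraph.hasse {i // i ∈ J}).Reachable ⟨a, ha⟩ b := by
      have := h (J.filter (fun b => ∃ hb : b ∈ J,
        (SimpleGraph.hasse {i // i ∈ J}).Reachable ⟨a, ha⟩ ⟨b, hb⟩))
        (Finset.filter_subset _ _) ⟨a, by simp [ha]⟩ ?_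
      · rintro ⟨b, hb⟩
        obtain ⟨_, h⟩ := (Finset.mem_filter.mp (this hb)).2
        exact h
      · intro x hx b hb hab
        obtain ⟨hxJ, hr⟩ := (Finset.mem_filter.mp hx).2
        refine Finset.mem_filter.mpr ⟨hb, hb, hr.trans ?_⟩
        rcases hab with h | h
        · exact SimpleGraph.hasse_reachable_of_le (a := (⟨x, hxJ⟩ : {i // i ∈ J})) h
        · exact (SimpleGraph.hasse_reachable_of_le (b := (⟨x, hxJ⟩ : {i // i ∈ J})) h).symm
    have : Nonempty {i // i ∈ J} := ⟨⟨a, ha⟩⟩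
    exact ⟨fun x y => (key x).symm.trans (key y)⟩

/-! ### Connected order ideals -/

namespace ConnIdeal

variable {P : PartialOrder (Fin n)}

theorem isOrderIdeal (J : ConnIdeal P) : IsOrderIdeal P J.1 := J.2.1

theorem compConnected (J : ConnIdeal P) : CompConnected P J.1 :=
  (hasseDiagram_connected_iff P J.1).mp J.2.2

theorem nonempty (J : ConnIdeal P) : J.1.Nonempty := J.compConnected.1

/-- A connected order ideal from the comparability criterion. -/
def ofCompConnected (J : Finset (Fin n)) (h : IsOrderIdeal P J) (h' : CompConnected P J) :
    ConnIdeal P := ⟨J, h, (hasseDiagram_connected_iff P J).mpr h'⟩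

@[ext] theorem ext' {A B : ConnIdeal P} (h : A.1 = B.1) : A = B := Subtype.ext h

theorem ssubset_of_subset_of_ne {A B : ConnIdeal P} (h : A.1 ⊆ B.1) (hne : A ≠ B) :
    A.1 ⊂ B.1 :=
  Finset.ssubset_iff_subset_ne.mpr ⟨h, fun h => hne (ext' h)⟩

open scoped Classical in
/-- The union of a family of connected order ideals through a common element. -/
noncomputable def biUnion (S : Finset (ConnIdeal P)) (x : Fin n) (hS : S.Nonempty)
    (h : ∀ J ∈ S, x ∈ J.1) : ConnIdeal P :=
  ofCompConnected (S.biUnion (fun J => J.1))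
    (by
      intro i j hi hji
      obtain ⟨J, hJ, hiJ⟩ := Finset.mem_biUnion.mp hi
      exact Finset.mem_biUnion.mpr ⟨J, hJ, J.isOrderIdeal i j hiJ hji⟩)
    (by
      obtain ⟨J₀, hJ₀⟩ := hS
      refine ⟨⟨x, Finset.mem_biUnion.mpr ⟨J₀, hJ₀, h _ hJ₀⟩⟩, ?_⟩
      rintro A hA ⟨a, ha⟩ hcl
      have step : ∀ J ∈ S, ∀ y ∈ J.1, y ∈ A → J.1 ⊆ A := by
        intro J hJ y hy hyA
        refine (J.compConnected.2 (A ∩ J.1) Finset.inter_subset_right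
          ⟨y, Finset.mem_inter.mpr ⟨hyA, hy⟩⟩ ?_).trans Finset.inter_subset_left
        intro u hu v hv huv
        exact Finset.mem_inter.mpr ⟨hcl u (Finset.mem_inter.mp hu).1 v
          (Finset.mem_biUnion.mpr ⟨J, hJ, hv⟩) huv, hv⟩
      obtain ⟨J₁, hJ₁, haJ₁⟩ := Finset.mem_biUnion.mp (hA ha)
      have hxA := step J₁ hJ₁ a haJ₁ ha (h _ hJ₁)
      intro b hb
      obtain ⟨J, hJ, hbJ⟩ := Finset.mem_biUnion.mp hb
      exact step J hJ x (h _ hJ) hxA hbJ)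

open scoped Classical in
theorem mem_biUnion {S : Finset (ConnIdeal P)} {x : Fin n} {hS : S.Nonempty}
    {h : ∀ J ∈ S, x ∈ J.1} {y : Fin n} : y ∈ (biUnion S x hS h).1 ↔ ∃ J ∈ S, y ∈ J.1 :=
  Finset.mem_biUnion

/-- The union of two connected order ideals that meet. -/
theorem exists_union {A B : ConnIdeal P} (h : (A.1 ∩ B.1).Nonempty) :
    ∃ K : ConnIdeal P, K.1 = A.1 ∪ B.1 := by
  classical
  obtain ⟨x, hx⟩ := h
  rw [Finset.mem_inter] at hx
  refine ⟨biUnion {A, B} x (by simp) (by simp [hx.1, hx.2]), ?_⟩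
  ext y
  rw [mem_biUnion]
  simp

/-- The principal order ideal of an element is connected. -/
theorem exists_principal (P : PartialOrder (Fin n)) (j : Fin n) :
    ∃ K : ConnIdeal P, ∀ i, i ∈ K.1 ↔ P.le i j := by
  classical
  refine ⟨ofCompConnected (Finset.univ.filter (fun i => P.le i j)) ?_ ⟨⟨j, ?_⟩, ?_⟩, ?_⟩
  · intro i k hi hk
    simp only [Finset.mem_filter, Finset.mem_univ, true_and] at hi ⊢
    exact P.le_trans _ _ _ hk hi
  · simp only [Finset.mem_filter, Finset.mem_univ, true_and]
    exact P.le_refl j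
  · rintro A hA ⟨a, ha⟩ hcl b hb
    have hj : j ∈ A := hcl a ha j (by simp)
      (Or.inl (by simpa using hA ha))
    exact hcl j hj b hb (Or.inr (by simpa using hb))
  · intro i
    simp [ofCompConnected]

/-- A connected order ideal that leaves a smaller one does so along a relation of `P`. -/
theorem exists_lt_of_ssubset {J : ConnIdeal P} {A : Finset (Fin n)} (hne : A.Nonempty)
    (hA : IsOrderIdeal P A) (h : A ⊂ J.1) : ∃ y ∈ A, ∃ x ∈ J.1, x ∉ A ∧ P.lt y x := by
  by_contra! hcon
  refine h.2 (J.compConnected.2 A h.1 hne ?_)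
  rintro a ha b hb (hab | hab)
  · by_contra hbA
    refine hcon a ha b hb hbA ((@lt_iff_le_and_ne _ P a b).mpr ⟨hab, ?_⟩)
    rintro rfl
    exact hbA ha
  · exact hA a b ha hab

end ConnIdeal

/-! ### Independent sets as laminar families with labels -/

variable {P : PartialOrder (Fin n)}

/-- Independent sets of `G_P` are the families whose members are pairwise nested or disjoint. -/
theorem isIndepSet_iff {M : Set (ConnIdeal P)} : (graph P).IsIndepSet M ↔
    ∀ A ∈ M, ∀ B ∈ M, (A.1 ∩ B.1).Nonempty → A.1 ⊆ B.1 ∨ B.1 ⊆ A.1 := by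
  constructor
  · intro h A hA B hB hAB
    by_cases heq : A = B
    · subst heq; exact Or.inl (Finset.Subset.refl _)
    · have := h hA hB heq
      by_contra! hcon
      exact this ⟨hAB, hcon.1, hcon.2⟩
  · intro h A hA B hB _ hadj
    rcases h A hA B hB hadj.1 with h' | h'
    · exact hadj.2.1 h'
    · exact hadj.2.2 h'

theorem subset_or_ssubset_of_mem {M : Set (ConnIdeal P)} (h : (graph P).IsIndepSet M)
    {A B : ConnIdeal P} (hA : A ∈ M) (hB : B ∈ M) {x : Fin n} (hxA : x ∈ A.1) (hxB : x ∈ B.1) :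
    A.1 ⊆ B.1 ∨ B.1 ⊂ A.1 := by
  rcases isIndepSet_iff.mp h A hA B hB ⟨x, Finset.mem_inter.mpr ⟨hxA, hxB⟩⟩ with h | h
  · exact Or.inl h
  · by_cases h' : A.1 ⊆ B.1
    · exact Or.inl h'
    · exact Or.inr ⟨h, h'⟩

theorem mem_mu {M : Finset (ConnIdeal P)} {J : ConnIdeal P} {x : Fin n} :
    x ∈ mu M J ↔ ∃ K ∈ M, K.1 ⊂ J.1 ∧ x ∈ K.1 := by
  classical
  simp [mu, and_assoc]

/-- Suppose smaller members covered `J`, and let `L` be one of largest size. Since `J` is connected,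
some relation of `P` leads from `L` to an element outside `L`. The smaller member covering that
element is an ideal, so it meets `L`; by laminarity it strictly contains `L`, against maximality. -/
theorem sdiff_mu_nonempty {M : Finset (ConnIdeal P)} (h : (graph P).IsIndepSet (M : Set _))
    (J : ConnIdeal P) : (J.1 \ mu M J).Nonempty := by
  classical
  rw [Finset.sdiff_nonempty]
  intro hsub
  obtain ⟨x, hx⟩ := J.nonempty
  obtain ⟨K, hK, hKJ, hxK⟩ := mem_mu.mp (hsub hx)
  obtain ⟨L, hL, hLmax⟩ := Finset.exists_max_image (M.filter (fun L => L.1 ⊂ J.1))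
    (fun L => L.1.card) ⟨K, by simp [hK, hKJ]⟩
  rw [Finset.mem_filter] at hL
  obtain ⟨y, hy, z, hz, hzL, hyz⟩ :=
    ConnIdeal.exists_lt_of_ssubset L.nonempty L.isOrderIdeal hL.2
  obtain ⟨K', hK', hKJ', hzK'⟩ := mem_mu.mp (hsub hz)
  have hyK' : y ∈ K'.1 := K'.isOrderIdeal z y hzK' hyz.le
  rcases subset_or_ssubset_of_mem h hK' hL.1 hyK' hy with h1 | h1
  · exact hzL (h1 hzK')
  · exact absurd (hLmax K' (by simp [hK', hKJ'])) (not_le.mpr (Finset.card_lt_card h1))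

theorem eq_of_mem_sdiff_mu {M : Finset (ConnIdeal P)} (h : (graph P).IsIndepSet (M : Set _))
    {A B : ConnIdeal P} (hA : A ∈ M) (hB : B ∈ M) {x : Fin n} (hxA : x ∈ A.1 \ mu M A)
    (hxB : x ∈ B.1 \ mu M B) : A = B := by
  rw [Finset.mem_sdiff] at hxA hxB
  rcases subset_or_ssubset_of_mem h hA hB hxA.1 hxB.1 with h1 | h1
  · by_contra hne
    exact hxB.2 (mem_mu.mpr ⟨A, hA, ConnIdeal.ssubset_of_subset_of_ne h1 hne, hxA.1⟩)
  · exact absurd (mem_mu.mpr ⟨B, hB, h1, hxB.1⟩) hxA.2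

/-- An element of `J` outside `μ(M, J)`. -/
theorem exists_label_injOn {M : Finset (ConnIdeal P)} (h : (graph P).IsIndepSet (M : Set _)) :
    ∃ l : ConnIdeal P → Fin n, (∀ J, l J ∈ J.1 \ mu M J) ∧ Set.InjOn l M := by
  choose l hl using fun J => sdiff_mu_nonempty h J
  refine ⟨l, hl, fun A hA B hB hAB => eq_of_mem_sdiff_mu h hA hB (hl A) ?_⟩
  rw [hAB]
  exact hl B

theorem card_le_of_isIndepSet {M : Finset (ConnIdeal P)}
    (h : (graph P).IsIndepSet (M : Set _)) : M.card ≤ n := by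
  obtain ⟨l, _, hl⟩ := exists_label_injOn h
  simpa using Finset.card_le_card_of_injOn l (fun _ _ => Finset.mem_univ _) hl

/-- An independent set with `n` members has exactly one label in each member, and every label
occurs. -/
structure Labeled (M : Finset (ConnIdeal P)) (l : ConnIdeal P → Fin n) (t : Fin n → ConnIdeal P) :
    Prop where
  indep : (graph P).IsIndepSet (M : Set _)
  sdiff_mu : ∀ J ∈ M, J.1 \ mu M J = {l J}
  top_mem : ∀ i, t i ∈ M
  label_top : ∀ i, l (t i) = i
  top_label : ∀ J ∈ M, t (l J) = J

/-- The sets `J \ mu M J` for `J ∈ M` are non-empty and pairwise disjoint; `n` such sets among `n`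
labels must be singletons that exhaust the labels. -/
theorem exists_labeled {M : Finset (ConnIdeal P)} (h : (graph P).IsIndepSet (M : Set _))
    (hc : M.card = n) : ∃ l t, Labeled M l t := by
  classical
  obtain ⟨l, hl, hinj⟩ := exists_label_injOn h
  have hsurj : ∀ i, ∃ J ∈ M, l J = i := by
    have : M.image l = Finset.univ := by
      apply Finset.eq_univ_of_card
      rw [Finset.card_image_of_injOn hinj, hc, Fintype.card_fin]
    intro i
    have hi := Finset.mem_univ i
    rw [← this, Finset.mem_image] at hi
    exact hi
  choose t ht hlt using hsurj
  refine ⟨l, t, h, ?_, ht, hlt, ?_⟩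
  · intro J hJ
    ext x
    rw [Finset.mem_singleton]
    constructor
    · intro hx
      have : t x = J := eq_of_mem_sdiff_mu h (ht x) hJ (by have := hl (t x); rwa [hlt] at this) hx
      rw [← this, hlt]
    · rintro rfl
      exact hl J
  · intro J hJ
    exact hinj (ht _) hJ (hlt _)

namespace Labeled

variable {M : Finset (ConnIdeal P)} {l : ConnIdeal P → Fin n} {t : Fin n → ConnIdeal P}

theorem label_mem (h : Labeled M l t) {J : ConnIdeal P} (hJ : J ∈ M) : l J ∈ J.1 := by
  have := h.sdiff_mu J hJ
  have hx : l J ∈ J.1 \ mu M J := by rw [this]; simp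
  exact (Finset.mem_sdiff.mp hx).1

theorem mem_top (h : Labeled M l t) (i : Fin n) : i ∈ (t i).1 := by
  have := h.label_mem (h.top_mem i)
  rwa [h.label_top] at this

/-- The label of `J` lies in no smaller member, so a member containing it contains all of `J`. This
turns sums over members through a label into sums over a chain of the forest. -/
theorem label_mem_iff (h : Labeled M l t) {J K : ConnIdeal P} (hJ : J ∈ M) (hK : K ∈ M) :
    l J ∈ K.1 ↔ J.1 ⊆ K.1 := by
  refine ⟨fun hl => ?_, fun hs => hs (h.label_mem hJ)⟩
  rcases subset_or_ssubset_of_mem h.indep hJ hK (h.label_mem hJ) hl with h1 | h1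
  · exact h1
  · have hx : l J ∈ J.1 \ mu M J := by rw [h.sdiff_mu J hJ]; simp
    exact absurd (mem_mu.mpr ⟨K, hK, h1, hl⟩) (Finset.mem_sdiff.mp hx).2

theorem mem_iff (h : Labeled M l t) {K : ConnIdeal P} (hK : K ∈ M) (i : Fin n) :
    i ∈ K.1 ↔ (t i).1 ⊆ K.1 := by
  rw [← h.label_mem_iff (h.top_mem i) hK, h.label_top]

theorem label_injOn (h : Labeled M l t) : Set.InjOn l M := by
  intro A hA B hB hAB
  rw [← h.top_label A hA, hAB, h.top_label B hB]

theorem forestLT_iff (h : Labeled M l t) (i j : Fin n) :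
    forestLT M i j ↔ (t i).1 ⊂ (t j).1 := by
  constructor
  · rintro ⟨A, hA, B, hB, hAB, hi, hj⟩
    rw [h.sdiff_mu A hA, Finset.singleton_inj] at hi
    rw [h.sdiff_mu B hB, Finset.singleton_inj] at hj
    rw [← hi, ← hj, h.top_label A hA, h.top_label B hB]
    exact hAB
  · intro hij
    refine ⟨t i, h.top_mem i, t j, h.top_mem j, hij, ?_, ?_⟩
    · rw [h.sdiff_mu _ (h.top_mem i), h.label_top]
    · rw [h.sdiff_mu _ (h.top_mem j), h.label_top]

theorem mem_Des_iff (h : Labeled M l t) (i : Fin n) :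
    i ∈ Des M ↔ ∃ j, j < i ∧ (t i).1 ⊂ (t j).1 ∧
      ∀ K ∈ M, (t i).1 ⊂ K.1 → ¬ K.1 ⊂ (t j).1 := by
  simp only [Des, IsParent, Set.mem_ofPred_eq, h.forestLT_iff]
  constructor
  · rintro ⟨j, ⟨h1, h2⟩, h3⟩
    refine ⟨j, h3, h1, fun K hK h4 h5 => h2 ⟨l K, ?_⟩⟩
    rw [h.top_label K hK]
    exact ⟨h4, h5⟩
  · rintro ⟨j, h3, h1, h2⟩
    refine ⟨j, ⟨h1, ?_⟩, h3⟩
    rintro ⟨k, h4, h5⟩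
    exact h2 _ (h.top_mem k) h4 h5

/-- Descent ideals in terms of members of `M`. -/
theorem mem_desBarRel_iff (h : Labeled M l t) {N : Finset (ConnIdeal P)} (hN : N ⊆ M)
    {J : ConnIdeal P} : J ∈ desBarRel N M ↔ J ∈ N ∧ ∃ K ∈ M, J.1 ⊂ K.1 ∧ l K < l J ∧
      ∀ L ∈ M, J.1 ⊂ L.1 → ¬ L.1 ⊂ K.1 := by
  classical
  rw [desBarRel, Finset.mem_filter]
  simp only [DesRel, Set.mem_ofPred_eq]
  refine and_congr_right fun hJ => ?_
  have hJM := hN hJ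
  constructor
  · rintro ⟨i, ⟨hi, -⟩, hJi⟩
    rw [h.sdiff_mu J hJM, Finset.singleton_inj] at hJi
    obtain ⟨j, h1, h2, h3⟩ := (h.mem_Des_iff i).mp hi
    rw [← hJi, h.top_label J hJM] at h2 h3
    exact ⟨t j, h.top_mem j, h2, by rwa [h.label_top, hJi], h3⟩
  · rintro ⟨K, hK, h1, h2, h3⟩
    refine ⟨l J, ⟨?_, J, hJ, (h.sdiff_mu J hJM).symm⟩, h.sdiff_mu J hJM⟩
    rw [h.mem_Des_iff]
    refine ⟨l K, h2, ?_⟩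
    rw [h.top_label J hJM, h.top_label K hK]
    exact ⟨h1, h3⟩

end Labeled


/-! ### The forest attached to a $P$-partition -/

/-- The total order on labels sorting the values of `f` decreasingly, ties by label. -/
def Prec (f : Fin n → ℕ) (i j : Fin n) : Prop := f j < f i ∨ (f i = f j ∧ i < j)

theorem Prec.trans {f : Fin n → ℕ} {i j k : Fin n} (h : Prec f i j) (h' : Prec f j k) :
    Prec f i k := by
  unfold Prec at *; omega

theorem Prec.irrefl {f : Fin n → ℕ} (i : Fin n) : ¬ Prec f i i := by
  unfold Prec; omega

theorem Prec.of_le_of_not_lt {f : Fin n → ℕ} {i j : Fin n} (h : f j ≤ f i) (hne : i ≠ j)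
    (h' : ¬ j < i) : Prec f i j := by
  unfold Prec; omega

theorem Prec.le {f : Fin n → ℕ} {i j : Fin n} (h : Prec f i j) : f j ≤ f i := by
  unfold Prec at h; omega

theorem Prec.lt_of_lt {f : Fin n → ℕ} {i j : Fin n} (h : Prec f i j) (h' : j < i) :
    f j < f i := by
  unfold Prec at h; omega

theorem Prec.asymm {f : Fin n → ℕ} {i j : Fin n} (h : Prec f i j) : ¬ Prec f j i :=
  fun h' => Prec.irrefl i (h.trans h')

theorem prec_trichotomy (f : Fin n → ℕ) (i j : Fin n) : Prec f i j ∨ i = j ∨ Prec f j i := by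
  unfold Prec; omega

/-- `≺_f` is a linear extension of the order of the labels of `M`. -/
def Compatible (M : Finset (ConnIdeal P)) (l : ConnIdeal P → Fin n) (f : Fin n → ℕ) : Prop :=
  ∀ J ∈ M, ∀ K ∈ M, J.1 ⊂ K.1 → Prec f (l J) (l K)

theorem Prec.of_lt (hP : NaturallyLabeled P) {f : Fin n → ℕ} (hf : IsPPartition P f)
    {i j : Fin n} (h : P.lt i j) : Prec f i j := by
  refine Prec.of_le_of_not_lt (hf.1 i j h) h.ne (Nat.lt_asymm (hP i j h))

/-- Among the connected order ideals through `j` whose elements precede `j`, there is a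
largest. -/
theorem exists_largest_ideal (hP : NaturallyLabeled P) {f : Fin n → ℕ} (hf : IsPPartition P f)
    (j : Fin n) : ∃ K : ConnIdeal P, j ∈ K.1 ∧ (∀ i ∈ K.1, i = j ∨ Prec f i j) ∧
      ∀ L : ConnIdeal P, j ∈ L.1 → (∀ i ∈ L.1, i = j ∨ Prec f i j) → L.1 ⊆ K.1 := by
  classical
  obtain ⟨L, hL⟩ := ConnIdeal.exists_principal P j
  have hjL : j ∈ L.1 := (hL j).mpr (P.le_refl j)
  have hLj : ∀ i ∈ L.1, i = j ∨ Prec f i j := by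
    intro i hi
    by_cases hij : i = j
    · exact Or.inl hij
    · exact Or.inr (Prec.of_lt hP hf ((@lt_iff_le_and_ne _ P i j).mpr ⟨(hL i).mp hi, hij⟩))
  refine ⟨ConnIdeal.biUnion
    (Finset.univ.filter (fun L => j ∈ L.1 ∧ ∀ i ∈ L.1, i = j ∨ Prec f i j)) j
    ⟨L, by simpa using ⟨hjL, hLj⟩⟩ ?_, ?_, ?_, ?_⟩
  · intro K hK
    exact (Finset.mem_filter.mp hK).2.1
  · exact ConnIdeal.mem_biUnion.mpr ⟨L, by simpa using ⟨hjL, hLj⟩, hjL⟩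
  · intro i hi
    obtain ⟨K, hK, hiK⟩ := ConnIdeal.mem_biUnion.mp hi
    exact (Finset.mem_filter.mp hK).2.2 i hiK
  · intro K hK hK' i hi
    exact ConnIdeal.mem_biUnion.mpr ⟨K, by simpa using ⟨hK, hK'⟩, hi⟩

/-- Every `P`-partition is compatible with exactly one independent set with `n` members. -/
theorem exists_unique_compatible (hP : NaturallyLabeled P) {f : Fin n → ℕ}
    (hf : IsPPartition P f) : ∃ M₀ : Finset (ConnIdeal P),
      (graph P).IsIndepSet (M₀ : Set (ConnIdeal P)) ∧ M₀.card = n ∧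
      ∀ M l t, Labeled (P := P) M l t → (Compatible M l f ↔ M = M₀) := by
  classical
  choose K hK hKprec hKmax using exists_largest_ideal hP hf
  have hinj : Function.Injective K := by
    intro i j hij
    have h1 := hKprec j i (hij ▸ hK i)
    have h2 := hKprec i j (hij ▸ hK j)
    rcases h1 with h1 | h1
    · exact h1
    · rcases h2 with h2 | h2
      · exact h2.symm
      · exact absurd h2 h1.asymm
  -- If `i` precedes `j`, every element of `K i` precedes `j` too, so the union of the two ideals
  -- still competes for the maximality of `K j`.
  have hsub : ∀ i j, ((K i).1 ∩ (K j).1).Nonempty → Prec f i j → (K i).1 ⊆ (K j).1 := by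
    intro i j hij hp
    obtain ⟨L, hL⟩ := ConnIdeal.exists_union hij
    have : L.1 ⊆ (K j).1 := by
      refine hKmax j L (by rw [hL]; exact Finset.mem_union_right _ (hK j)) ?_
      intro k hk
      rw [hL, Finset.mem_union] at hk
      rcases hk with hk | hk
      · rcases hKprec i k hk with rfl | h
        · exact Or.inr hp
        · exact Or.inr (h.trans hp)
      · exact hKprec j k hk
    rw [hL] at this
    exact Finset.subset_union_left.trans this
  have hind : (graph P).IsIndepSet ((Finset.univ.image K : Finset (ConnIdeal P)) : Set _) := by
    rw [isIndepSet_iff]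
    intro A hA B hB hAB
    simp only [Finset.coe_image, Finset.coe_univ, Set.image_univ, Set.mem_range] at hA hB
    obtain ⟨i, rfl⟩ := hA
    obtain ⟨j, rfl⟩ := hB
    rcases prec_trichotomy f i j with h | rfl | h
    · exact Or.inl (hsub i j hAB h)
    · exact Or.inl (Finset.Subset.refl _)
    · exact Or.inr (hsub j i (by rwa [Finset.inter_comm]) h)
  have hcard : (Finset.univ.image K).card = n := by
    rw [Finset.card_image_of_injective _ hinj, Finset.card_univ, Fintype.card_fin]
  have hmem : ∀ i, K i ∈ Finset.univ.image K :=
    fun i => Finset.mem_image_of_mem _ (Finset.mem_univ i)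
  refine ⟨Finset.univ.image K, hind, hcard, ?_⟩
  intro M l t h
  constructor
  · intro hc
    have hMcard : M.card = n := by
      have h2 : Set.BijOn l M Set.univ := ⟨fun _ _ => trivial, h.label_injOn,
        fun i _ => ⟨t i, h.top_mem i, h.label_top i⟩⟩
      have h3 : M.image l = Finset.univ := by
        ext i
        simp only [Finset.mem_image, Finset.mem_univ, iff_true]
        exact ⟨t i, h.top_mem i, h.label_top i⟩
      rw [← Finset.card_image_of_injOn h.label_injOn, h3, Finset.card_univ, Fintype.card_fin]
    refine Finset.eq_of_subset_of_card_le ?_ (by rw [hMcard, hcard])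
    intro J hJ
    -- Each other element of `J` labels a strictly smaller member, and so precedes `l J` by
    -- compatibility.
    have hJK : J.1 ⊆ (K (l J)).1 := by
      refine hKmax _ J (h.label_mem hJ) fun i hi => ?_
      by_cases hij : t i = J
      · exact Or.inl (by rw [← hij, h.label_top])
      · refine Or.inr ?_
        have := hc _ (h.top_mem i) J hJ
          (ConnIdeal.ssubset_of_subset_of_ne ((h.mem_iff hJ i).mp hi) hij)
        rwa [h.label_top] at this
    suffices J = K (l J) by rw [this]; exact hmem _
    -- Some relation `y < x` leaves `J` inside `K (l J)`. The member labeled `x` contains `y`, hence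
    -- strictly contains `J`, so `l J` precedes `x`; membership of `x` in `K (l J)` says the
    -- opposite.
    by_contra hne
    obtain ⟨y, hy, x, hx, hxJ, hyx⟩ := ConnIdeal.exists_lt_of_ssubset J.nonempty J.isOrderIdeal
      (ConnIdeal.ssubset_of_subset_of_ne hJK hne)
    have hytx : y ∈ (t x).1 := (t x).isOrderIdeal x y (h.mem_top x) hyx.le
    rcases subset_or_ssubset_of_mem h.indep (h.top_mem x) hJ hytx hy with h1 | h1
    · exact hxJ (h1 (h.mem_top x))
    · have h2 := hc J hJ _ (h.top_mem x) h1
      rw [h.label_top] at h2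
      rcases hKprec _ x hx with h3 | h3
      · rw [h3] at h2
        exact Prec.irrefl _ h2
      · exact h2.asymm h3
  · rintro rfl J hJ L hL hJL
    obtain ⟨i, -, rfl⟩ := Finset.mem_image.mp hJ
    obtain ⟨j, -, rfl⟩ := Finset.mem_image.mp hL
    -- If `k` lay in a smaller `K m`, then `k` and `m` would lie in each other's ideals and precede
    -- each other, which forces `k = m`.
    have hlab : ∀ k, l (K k) = k := by
      intro k
      have h1 : k ∈ (K k).1 \ mu (Finset.univ.image K) (K k) := by
        refine Finset.mem_sdiff.mpr ⟨hK k, fun hk => ?_⟩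
        obtain ⟨A, hA, hAk, hkA⟩ := mem_mu.mp hk
        obtain ⟨m, -, rfl⟩ := Finset.mem_image.mp hA
        have h2 := hKprec m k hkA
        have h3 := hKprec k m (hAk.1 (hK m))
        have : k = m := by
          rcases h2 with h2 | h2
          · exact h2
          · rcases h3 with h3 | h3
            · exact h3.symm
            · exact absurd h2 h3.asymm
        subst this
        exact hAk.2 (Finset.Subset.refl _)
      rw [h.sdiff_mu _ (hmem k), Finset.mem_singleton] at h1
      exact h1.symm
    rw [hlab, hlab]
    rcases hKprec j i (hJL.1 (hK i)) with rfl | h1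
    · exact absurd (Finset.Subset.refl _) hJL.2
    · exact h1

theorem isPPartition_zero (P : PartialOrder (Fin n)) (hP : NaturallyLabeled P) :
    IsPPartition P (fun _ => 0) :=
  ⟨fun _ _ _ => le_rfl, fun i j h hji => absurd (hP i j h) (Nat.lt_asymm hji)⟩

/-- Maximum independent sets of `G_P` are the independent sets with `n` members. -/
theorem isMaximumIndepSet_iff_card (hP : NaturallyLabeled P) {M : Finset (ConnIdeal P)} :
    (graph P).IsMaximumIndepSet M ↔ (graph P).IsIndepSet (M : Set _) ∧ M.card = n := by
  -- The zero map is a $P$-partition, so an independent set attaining the bound `n` exists.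
  obtain ⟨M₀, h₀, hc₀, -⟩ := exists_unique_compatible hP (isPPartition_zero P hP)
  constructor
  · intro h
    refine ⟨h.isIndepSet, le_antisymm (card_le_of_isIndepSet h.isIndepSet) ?_⟩
    have := h.maximum M₀ h₀
    rwa [hc₀] at this
  · rintro ⟨h, hc⟩
    exact ⟨h, fun N hN => by rw [hc]; exact card_le_of_isIndepSet hN⟩

/-! ### Coordinates for the $P$-partitions compatible with a forest -/

namespace Labeled

variable {M : Finset (ConnIdeal P)} {l : ConnIdeal P → Fin n} {t : Fin n → ConnIdeal P}

/-- A non-maximal member of `M` has a parent. -/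
theorem exists_parent (h : Labeled M l t) {J K : ConnIdeal P} (hK : K ∈ M) (hJK : J.1 ⊂ K.1) :
    ∃ L ∈ M, J.1 ⊂ L.1 ∧ ∀ N ∈ M, J.1 ⊂ N.1 → L.1 ⊆ N.1 := by
  classical
  obtain ⟨L, hL, hmin⟩ := Finset.exists_min_image (M.filter (fun L => J.1 ⊂ L.1))
    (fun L => L.1.card) ⟨K, by simp [hK, hJK]⟩
  rw [Finset.mem_filter] at hL
  refine ⟨L, hL.1, hL.2, fun N hN hJN => ?_⟩
  obtain ⟨x, hx⟩ := J.nonempty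
  rcases subset_or_ssubset_of_mem h.indep hL.1 hN (hL.2.1 hx) (hJN.1 hx) with h1 | h1
  · exact h1
  · exact absurd (hmin N (by simp [hN, hJN])) (not_le.mpr (Finset.card_lt_card h1))

-- The value of `f` at the label of `J` is the sum of `b` over the members containing `J`, so it
-- decreases weakly up the forest. At a descent the parent's sum loses the positive term `b J`,
-- which is the strictness that `Prec` asks for there.
open scoped Classical in
theorem compatible_of_sum (h : Labeled M l t) {f : Fin n → ℕ} {b : ConnIdeal P → ℕ}
    (hb : ∀ J ∈ desBarRel M M, 0 < b J)
    (hf : ∀ k, f k = ∑ J ∈ M with k ∈ J.1, b J) : Compatible M l f := by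
  have hf' : ∀ J ∈ M, f (l J) = ∑ K ∈ M with J.1 ⊆ K.1, b K := by
    intro J hJ
    rw [hf]
    refine Finset.sum_congr (Finset.filter_congr fun K hK => h.label_mem_iff hJ hK) fun _ _ => rfl
  have hle : ∀ J K : ConnIdeal P, J.1 ⊆ K.1 →
      (M.filter fun L => K.1 ⊆ L.1) ⊆ M.filter fun L => J.1 ⊆ L.1 := by
    intro J K hJK
    exact Finset.monotone_filter_right _ fun L _ hL => hJK.trans hL
  -- Induction on the gap in cardinality reduces the claim, by transitivity, to pairs with no member
  -- strictly between; a gap of zero is impossible.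
  have key : ∀ d : ℕ, ∀ J ∈ M, ∀ K ∈ M, J.1 ⊂ K.1 → K.1.card - J.1.card ≤ d →
      Prec f (l J) (l K) := by
    intro d
    induction d with
    | zero =>
      intro J _ K _ hJK hd
      have := Finset.card_lt_card hJK
      omega
    | succ d ih =>
      intro J hJ K hK hJK hd
      by_cases hL : ∃ L ∈ M, J.1 ⊂ L.1 ∧ L.1 ⊂ K.1
      · obtain ⟨L, hL, h1, h2⟩ := hL
        have h3 := Finset.card_lt_card h1
        have h4 := Finset.card_lt_card h2
        exact (ih J hJ L hL h1 (by omega)).trans (ih L hL K hK h2 (by omega))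
      · push Not at hL
        have h1 : f (l K) ≤ f (l J) := by
          rw [hf' J hJ, hf' K hK]
          exact Finset.sum_le_sum_of_subset (hle J K hJK.1)
        have hne : l J ≠ l K := fun hlab => by
          rw [h.label_injOn hJ hK hlab] at hJK
          exact hJK.2 (Finset.Subset.refl _)
        by_cases hlt : l K < l J
        · have hD : J ∈ desBarRel M M :=
            (h.mem_desBarRel_iff (Finset.Subset.refl M)).mpr ⟨hJ, K, hK, hJK, hlt, hL⟩
          left
          rw [hf' J hJ, hf' K hK]
          refine Finset.sum_lt_sum_of_subset (hle J K hJK.1) (i := J) ?_ ?_ (hb J hD)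
            fun _ _ _ => Nat.zero_le _
          · simp [hJ]
          · simp [hJK.2]
        · exact Prec.of_le_of_not_lt h1 hne hlt
  exact fun J hJ K hK hJK => key _ J hJ K hK hJK le_rfl

-- The coefficient at `J` is the drop of `f` from the label of `J` to the label of its parent; the
-- drops telescope along the chain of members above `J`.
open scoped Classical in
theorem exists_sum_of_compatible (h : Labeled M l t) {f : Fin n → ℕ} (hc : Compatible M l f) :
    ∃ b : ConnIdeal P → ℕ, (∀ J ∈ desBarRel M M, 0 < b J) ∧
      ∀ k, f k = ∑ J ∈ M with k ∈ J.1, b J := by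
  have hmono : ∀ J ∈ M, ∀ K ∈ M, J.1 ⊆ K.1 → f (l K) ≤ f (l J) := by
    intro J hJ K hK hJK
    by_cases hne : J = K
    · rw [hne]
    · exact (hc J hJ K hK (ConnIdeal.ssubset_of_subset_of_ne hJK hne)).le
  -- The value of `f` at the parent's label: compatibility makes the parent attain the supremum. At
  -- a root the supremum is over the empty set and gives `0`, so the drop is the full value.
  set s : ConnIdeal P → ℕ := fun J => (M.filter fun K => J.1 ⊂ K.1).sup fun K => f (l K) with hs
  have hsle : ∀ J ∈ M, s J ≤ f (l J) := by
    intro J hJ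
    refine Finset.sup_le fun K hK => ?_
    rw [Finset.mem_filter] at hK
    exact hmono J hJ K hK.1 hK.2.1
  have hsp : ∀ J, ∀ L ∈ M, J.1 ⊂ L.1 → (∀ N ∈ M, J.1 ⊂ N.1 → L.1 ⊆ N.1) → s J = f (l L) := by
    intro J L hL hJL hmin
    apply le_antisymm
    · refine Finset.sup_le fun K hK => ?_
      rw [Finset.mem_filter] at hK
      exact hmono L hL K hK.1 (hmin K hK.1 hK.2)
    · exact Finset.le_sup (f := fun K => f (l K)) (Finset.mem_filter.mpr ⟨hL, hJL⟩)
  refine ⟨fun J => f (l J) - s J, ?_, ?_⟩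
  · intro J hJ
    obtain ⟨hJM, K, hK, hJK, hlt, hmin⟩ :=
      (h.mem_desBarRel_iff (Finset.Subset.refl M)).mp hJ
    have h1 : s J = f (l K) := by
      obtain ⟨L, hL, hJL, hLmin⟩ := h.exists_parent hK hJK
      have : L = K := by
        by_contra hne
        exact hmin L hL hJL (ConnIdeal.ssubset_of_subset_of_ne (hLmin K hK hJK) hne)
      subst this
      exact hsp J L hL hJL hLmin
    have h2 := (hc J hJM K hK hJK).lt_of_lt hlt
    change 0 < f (l J) - s J
    omega
  -- Telescoping downwards from the largest ideals; in the base case `J` is the whole label set.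
  · have key : ∀ d : ℕ, ∀ J ∈ M, n - J.1.card ≤ d →
        f (l J) = ∑ K ∈ M with J.1 ⊆ K.1, (f (l K) - s K) := by
      intro d
      induction d with
      | zero =>
        intro J hJ hd
        have hfull : J.1 = Finset.univ := by
          rw [← Finset.card_eq_iff_eq_univ, Fintype.card_fin]
          have := Finset.card_le_univ J.1
          rw [Fintype.card_fin] at this
          omega
        have h1 : (M.filter fun K => J.1 ⊂ K.1) = ∅ := by
          refine Finset.filter_eq_empty_iff.mpr fun K _ hK => ?_
          rw [hfull] at hK
          exact hK.2 (Finset.subset_univ _)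
        have h2 : (M.filter fun K => J.1 ⊆ K.1) = {J} := by
          ext K
          simp only [Finset.mem_filter, Finset.mem_singleton]
          constructor
          · rintro ⟨_, hK⟩
            apply ConnIdeal.ext'
            rw [hfull] at hK ⊢
            exact Finset.univ_subset_iff.mp hK
          · rintro rfl
            exact ⟨hJ, Finset.Subset.refl _⟩
        rw [h2, Finset.sum_singleton]
        simp [hs, h1]
      | succ d ih =>
        intro J hJ hd
        have hins : (M.filter fun K => J.1 ⊆ K.1) = insert J (M.filter fun K => J.1 ⊂ K.1) := by
          ext K
          simp only [Finset.mem_filter, Finset.mem_insert]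
          constructor
          · rintro ⟨hK, hJK⟩
            by_cases hne : J = K
            · exact Or.inl hne.symm
            · exact Or.inr ⟨hK, ConnIdeal.ssubset_of_subset_of_ne hJK hne⟩
          · rintro (rfl | ⟨hK, hJK⟩)
            · exact ⟨hJ, Finset.Subset.refl _⟩
            · exact ⟨hK, hJK.1⟩
        rw [hins, Finset.sum_insert (by simp)]
        by_cases hex : ∃ K ∈ M, J.1 ⊂ K.1
        · obtain ⟨K, hK, hJK⟩ := hex
          obtain ⟨L, hL, hJL, hLmin⟩ := h.exists_parent hK hJK
          have h1 : (M.filter fun K => J.1 ⊂ K.1) = M.filter fun K => L.1 ⊆ K.1 :=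
            Finset.filter_congr fun N hN =>
              ⟨fun h' => hLmin N hN h', fun h' => hJL.trans_subset h'⟩
          have h2 := Finset.card_lt_card hJL
          have h4 := Finset.card_le_univ L.1
          rw [Fintype.card_fin] at h4
          have h3 := hmono J hJ L hL hJL.1
          rw [h1, ← ih L hL (by omega), hsp J L hL hJL hLmin]
          omega
        · have h1 : (M.filter fun K => J.1 ⊂ K.1) = ∅ :=
            Finset.filter_eq_empty_iff.mpr fun K hK hJK => hex ⟨K, hK, hJK⟩
          rw [h1]
          simp [hs, h1]
    intro k
    have h1 := key _ (t k) (h.top_mem k) le_rfl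
    rw [h.label_top] at h1
    rw [h1]
    exact Finset.sum_congr
      (Finset.filter_congr fun K hK => (h.mem_iff hK k).symm) fun _ _ => rfl

end Labeled

-- Indicators of order ideals decrease weakly along `P`, and natural labeling leaves no strict
-- conditions. Hence a map that is not a $P$-partition is compatible with no forest.
open scoped Classical in
theorem isPPartition_of_sum (hP : NaturallyLabeled P) {M : Finset (ConnIdeal P)}
    {f : Fin n → ℕ} {b : ConnIdeal P → ℕ} (hf : ∀ k, f k = ∑ J ∈ M with k ∈ J.1, b J) :
    IsPPartition P f := by
  refine ⟨fun i j hij => ?_, fun i j h hji => absurd (hP i j h) (Nat.lt_asymm hji)⟩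
  rw [hf i, hf j]
  exact Finset.sum_le_sum_of_subset
    (Finset.monotone_filter_right _ fun J _ hJ => J.isOrderIdeal j i hJ hij.le)

end PPart

/-! ### Products of geometric series with independent exponents -/

namespace MvPowerSeries

open scoped Classical in
/-- If the exponents `v i`, `i ∈ S`, are independent over `ℕ`, then `x^d ∏ (1 - x^(v i))⁻¹` is the
sum of the monomials with exponents `d + ∑ a i • v i`. -/
theorem coeff_monomial_mul_prod_one_sub_inv {σ ι k : Type*} [Field k] (v : ι → σ →₀ ℕ)
    (d : σ →₀ ℕ) (S : Finset ι)
    (hinj : ∀ a b : ι → ℕ, ∑ i ∈ S, a i • v i = ∑ i ∈ S, b i • v i → ∀ i ∈ S, a i = b i)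
    (f : σ →₀ ℕ) :
    coeff f (monomial d (1 : k) * ∏ i ∈ S, (1 - monomial (v i) (1 : k))⁻¹) =
      if ∃ a : ι → ℕ, f = d + ∑ i ∈ S, a i • v i then 1 else 0 := by
  induction S using Finset.induction_on generalizing f with
  | empty => simp [coeff_monomial]
  | insert j S hj ih =>
    have hsum : ∀ (a : ι → ℕ) (c : ℕ),
        ∑ i ∈ S, Function.update a j c i • v i = ∑ i ∈ S, a i • v i := by
      intro a c
      refine Finset.sum_congr rfl fun i hi => ?_
      rw [Function.update_of_ne (by rintro rfl; exact hj hi)]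
    have hext : ∀ (a : ι → ℕ) (c : ℕ), ∑ i ∈ insert j S, Function.update a j c i • v i =
        c • v j + ∑ i ∈ S, a i • v i := by
      intro a c
      rw [Finset.sum_insert hj, hsum, Function.update_self]
    have hinj' : ∀ (a b : ι → ℕ) (c e : ℕ),
        c • v j + ∑ i ∈ S, a i • v i = e • v j + ∑ i ∈ S, b i • v i →
        c = e ∧ ∀ i ∈ S, a i = b i := by
      intro a b c e h
      rw [← hext, ← hext] at h
      have := hinj _ _ h
      refine ⟨by simpa using this j (Finset.mem_insert_self _ _), fun i hi => ?_⟩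
      have h2 := this i (Finset.mem_insert_of_mem hi)
      have hij : i ≠ j := by rintro rfl; exact hj hi
      rwa [Function.update_of_ne hij, Function.update_of_ne hij] at h2
    -- Independence excludes a zero exponent, which makes the constant coefficient of `1 - x^(v j)`
    -- non-zero.
    have hv : v j ≠ 0 := by
      intro h
      have := (hinj' (fun _ => 0) (fun _ => 0) 0 1 (by simp [h])).1
      omega
    have hiff : ∀ f, (∃ a : ι → ℕ, f = d + ∑ i ∈ insert j S, a i • v i) ↔
        ∃ (a : ι → ℕ) (c : ℕ), f = d + (c • v j + ∑ i ∈ S, a i • v i) := by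
      intro f
      constructor
      · rintro ⟨a, ha⟩
        exact ⟨a, a j, by rw [ha, Finset.sum_insert hj]⟩
      · rintro ⟨a, c, h⟩
        exact ⟨Function.update a j c, by rw [hext, h]⟩
    have ihS := ih (fun a b h i hi => (hinj' a b 0 0 (by rw [h])).2 i hi)
    -- The claimed series is multiplied by `1 - x^(v j)`: exponents using `v j` at least once
    -- cancel, and by independence those not using it survive, which leaves the series for `S`.
    set T : MvPowerSeries σ k := fun f =>
      if ∃ a : ι → ℕ, f = d + ∑ i ∈ insert j S, a i • v i then 1 else 0 with hT
    have hTc : ∀ f, coeff f T = if ∃ a : ι → ℕ, f = d + ∑ i ∈ insert j S, a i • v i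
      then 1 else 0 := fun f => rfl
    rw [← hTc]
    congr 1
    have hc : constantCoeff (1 - monomial (v j) (1 : k)) ≠ 0 := by
      rw [map_sub, ← coeff_zero_eq_constantCoeff_apply, ← coeff_zero_eq_constantCoeff_apply,
        coeff_monomial, if_neg (Ne.symm hv)]
      simp
    rw [Finset.prod_insert hj, mul_comm _⁻¹, ← mul_assoc, eq_comm,
      MvPowerSeries.eq_mul_inv_iff_mul_eq hc]
    ext f
    rw [ihS, mul_sub, mul_one, map_sub, coeff_mul_monomial, hTc, hTc, mul_one]
    simp only [hiff]
    by_cases h1 : ∃ a : ι → ℕ, f = d + ∑ i ∈ S, a i • v i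
    · obtain ⟨a, rfl⟩ := h1
      have h0 : ∃ b : ι → ℕ, d + ∑ i ∈ S, a i • v i = d + ∑ i ∈ S, b i • v i := ⟨a, rfl⟩
      rw [if_pos ⟨a, 0, by simp⟩, if_pos h0]
      split_ifs with h2 h3
      · obtain ⟨b, c, h3⟩ := h3
        rw [tsub_eq_iff_eq_add_of_le h2] at h3
        have h4 : 0 • v j + ∑ i ∈ S, a i • v i = (c + 1) • v j + ∑ i ∈ S, b i • v i := by
          rw [add_assoc] at h3
          have := add_left_cancel h3
          rw [zero_smul, zero_add, this, add_smul, one_smul]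
          abel
        have := (hinj' _ _ _ _ h4).1
        omega
      · simp
      · simp
    · rw [if_neg h1]
      by_cases h2 : ∃ (a : ι → ℕ) (c : ℕ), f = d + (c • v j + ∑ i ∈ S, a i • v i)
      · obtain ⟨a, c, rfl⟩ := h2
        obtain ⟨c, rfl⟩ : ∃ c', c = c' + 1 := by
          refine Nat.exists_eq_succ_of_ne_zero fun h => h1 ⟨a, ?_⟩
          rw [h]; simp
        have h3 : d + ((c + 1) • v j + ∑ i ∈ S, a i • v i) =
            d + (c • v j + ∑ i ∈ S, a i • v i) + v j := by
          rw [add_smul, one_smul]; abel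
        rw [if_pos ⟨a, c + 1, rfl⟩, h3, if_pos le_add_self, add_tsub_cancel_right,
          if_pos ⟨a, c, rfl⟩, sub_self]
      · rw [if_neg h2]
        split_ifs with h3 h4
        · obtain ⟨a, c, h4⟩ := h4
          rw [tsub_eq_iff_eq_add_of_le h3] at h4
          refine absurd ⟨a, c + 1, ?_⟩ h2
          rw [h4, add_smul, one_smul]
          abel
        · simp
        · simp

theorem prod_monomial_one {σ ι R : Type*} [CommSemiring R] (S : Finset ι) (v : ι → σ →₀ ℕ) :
    ∏ i ∈ S, monomial (v i) (1 : R) = monomial (∑ i ∈ S, v i) 1 := by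
  classical
  induction S using Finset.induction_on with
  | empty => simp [monomial_zero_one]
  | insert j S hj ih => rw [Finset.prod_insert hj, Finset.sum_insert hj, ih, monomial_mul_monomial,
      one_mul]

end MvPowerSeries

/-! ### Generating function of one forest, and the sum over forests -/

namespace PPart

variable {n : ℕ} {P : PartialOrder (Fin n)}

/-- The exponent vector of `x^J`. -/
noncomputable def ConnIdeal.exponent (J : ConnIdeal P) : Fin n →₀ ℕ :=
  ∑ k ∈ J.1, Finsupp.single k 1

theorem ConnIdeal.exponent_apply (J : ConnIdeal P) (k : Fin n) :
    J.exponent k = if k ∈ J.1 then 1 else 0 := by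
  classical
  simp [exponent, Finsupp.finsetSum_apply, Finsupp.single_apply]

theorem mono_eq_monomial (J : ConnIdeal P) : mono J = MvPowerSeries.monomial J.exponent 1 := by
  rw [mono, ConnIdeal.exponent, ← MvPowerSeries.prod_monomial_one]
  rfl

open scoped Classical in
theorem sum_exponent_apply (M : Finset (ConnIdeal P)) (a : ConnIdeal P → ℕ) (k : Fin n) :
    (∑ J ∈ M, a J • J.exponent) k = ∑ J ∈ M with k ∈ J.1, a J := by
  simp [Finsupp.finsetSum_apply, ConnIdeal.exponent_apply, Finset.sum_filter]

open scoped Classical in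
theorem desBarRel_subset (N M : Finset (ConnIdeal P)) : desBarRel N M ⊆ N :=
  Finset.filter_subset _ _

namespace Labeled

variable {M : Finset (ConnIdeal P)} {l : ConnIdeal P → Fin n} {t : Fin n → ConnIdeal P}

/-- At the label of `J` only members containing `J` contribute, so the system is triangular and is
solved from the largest ideals down. -/
theorem exponent_independent (h : Labeled M l t) (a b : ConnIdeal P → ℕ)
    (hab : ∑ J ∈ M, a J • J.exponent = ∑ J ∈ M, b J • J.exponent) : ∀ J ∈ M, a J = b J := by
  classical
  have key : ∀ d : ℕ, ∀ J ∈ M, n - J.1.card < d → a J = b J := by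
    intro d
    induction d with
    | zero => intro J _ hd; omega
    | succ d ih =>
      intro J hJ hd
      have h1 := DFunLike.congr_fun hab (l J)
      rw [sum_exponent_apply, sum_exponent_apply] at h1
      have h2 : (M.filter fun K => l J ∈ K.1) = insert J (M.filter fun K => J.1 ⊂ K.1) := by
        ext K
        simp only [Finset.mem_filter, Finset.mem_insert]
        constructor
        · rintro ⟨hK, hl⟩
          by_cases hne : J = K
          · exact Or.inl hne.symm
          · exact Or.inr ⟨hK,
              ConnIdeal.ssubset_of_subset_of_ne ((h.label_mem_iff hJ hK).mp hl) hne⟩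
        · rintro (rfl | ⟨hK, hJK⟩)
          · exact ⟨hJ, h.label_mem hJ⟩
          · exact ⟨hK, hJK.1 (h.label_mem hJ)⟩
      rw [h2, Finset.sum_insert (by simp), Finset.sum_insert (by simp)] at h1
      have h3 : ∑ K ∈ M with J.1 ⊂ K.1, a K = ∑ K ∈ M with J.1 ⊂ K.1, b K := by
        refine Finset.sum_congr rfl fun K hK => ?_
        rw [Finset.mem_filter] at hK
        have h4 := Finset.card_lt_card hK.2
        have h5 := Finset.card_le_univ K.1
        rw [Fintype.card_fin] at h5
        exact ih K hK.1 (by omega)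
      omega
  exact fun J hJ => key _ J hJ (Nat.lt_succ_self _)

theorem exists_exponent_eq_iff (h : Labeled M l t) (f : Fin n →₀ ℕ) :
    (∃ a : ConnIdeal P → ℕ, f = ∑ J ∈ desBarRel M M, J.exponent + ∑ J ∈ M, a J • J.exponent) ↔
      Compatible M l f := by
  classical
  have hD : ∑ J ∈ desBarRel M M, J.exponent =
      ∑ J ∈ M, (if J ∈ desBarRel M M then 1 else 0) • J.exponent := by
    simp only [ite_smul, one_smul, zero_smul, ← Finset.sum_filter]
    refine Finset.sum_congr ?_ fun _ _ => rfl
    ext J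
    rw [Finset.mem_filter]
    exact ⟨fun hJ => ⟨desBarRel_subset _ _ hJ, hJ⟩, fun hJ => hJ.2⟩
  constructor
  · rintro ⟨a, ha⟩
    rw [hD, ← Finset.sum_add_distrib] at ha
    simp only [← add_smul] at ha
    refine h.compatible_of_sum (b := fun J => (if J ∈ desBarRel M M then 1 else 0) + a J) ?_ ?_
    · intro J hJ
      simp [hJ]
    · intro k
      conv_lhs => rw [ha]
      exact sum_exponent_apply _ _ _
  · intro hc
    obtain ⟨b, hb, hf⟩ := h.exists_sum_of_compatible hc
    -- The mandatory unit at each descent moves into the numerator monomial; `b J` is positive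
    -- there, so truncated subtraction is exact.
    refine ⟨fun J => b J - if J ∈ desBarRel M M then 1 else 0, ?_⟩
    rw [hD, ← Finset.sum_add_distrib]
    simp only [← add_smul]
    ext k
    rw [sum_exponent_apply, hf]
    refine Finset.sum_congr rfl fun J _ => ?_
    split_ifs with hJ
    · have := hb J hJ
      omega
    · omega

open scoped Classical in
theorem coeff_term (h : Labeled M l t) (f : Fin n →₀ ℕ) :
    MvPowerSeries.coeff f ((∏ J ∈ desBarRel M M, mono J) * ∏ J ∈ M, (1 - mono J)⁻¹) =
      if Compatible M l f then 1 else 0 := by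
  simp only [mono_eq_monomial]
  rw [MvPowerSeries.prod_monomial_one,
    MvPowerSeries.coeff_monomial_mul_prod_one_sub_inv _ _ _ h.exponent_independent]
  simp only [h.exists_exponent_eq_iff]

end Labeled

open scoped Classical in
/-- `F_P` is the sum of the generating functions of the forests `F_M`. -/
theorem genFun_eq_sum (hP : NaturallyLabeled P) :
    genFun P = ∑ M : Finset (ConnIdeal P) with (graph P).IsMaximumIndepSet M,
      (∏ J ∈ desBarRel M M, mono J) * ∏ J ∈ M, (1 - mono J)⁻¹ := by
  ext f
  rw [map_sum]
  have hlab : ∀ M : Finset (ConnIdeal P), (graph P).IsMaximumIndepSet M → ∃ l t, Labeled M l t :=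
    fun M hM => exists_labeled hM.isIndepSet ((isMaximumIndepSet_iff_card hP).mp hM).2
  have hgen : MvPowerSeries.coeff f (genFun P) = if IsPPartition P f then 1 else 0 := rfl
  rw [hgen]
  split_ifs with hf
  · obtain ⟨M₀, h₀, hc₀, huniq⟩ := exists_unique_compatible hP hf
    have hM₀ := (isMaximumIndepSet_iff_card hP).mpr ⟨h₀, hc₀⟩
    rw [Finset.sum_eq_single M₀]
    · obtain ⟨l, t, h⟩ := hlab M₀ hM₀
      rw [h.coeff_term, if_pos ((huniq _ _ _ h).mpr rfl)]
    · intro M hM hne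
      obtain ⟨l, t, h⟩ := hlab M (Finset.mem_filter.mp hM).2
      rw [h.coeff_term, if_neg fun hc => hne ((huniq _ _ _ h).mp hc)]
    · intro h
      exact absurd (Finset.mem_filter.mpr ⟨Finset.mem_univ _, hM₀⟩) h
  · symm
    refine Finset.sum_eq_zero fun M hM => ?_
    obtain ⟨l, t, h⟩ := hlab M (Finset.mem_filter.mp hM).2
    rw [h.coeff_term, if_neg fun hc => hf ?_]
    obtain ⟨b, -, hb⟩ := h.exists_sum_of_compatible hc
    exact isPPartition_of_sum hP hb


/-! ### Components of $G_P$ and isolated vertices -/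

/-- A vertex of `G_P` without neighbours. -/
def Isolated (J : ConnIdeal P) : Prop := ∀ K, ¬ (graph P).Adj J K

theorem subset_or_subset_of_not_adj {A B : ConnIdeal P} (h : ¬ (graph P).Adj A B)
    (hAB : (A.1 ∩ B.1).Nonempty) : A.1 ⊆ B.1 ∨ B.1 ⊆ A.1 := by
  by_contra! hcon
  exact h ⟨hAB, hcon.1, hcon.2⟩

theorem Isolated.eq_of_reachable {J K : ConnIdeal P} (h : Isolated J)
    (hr : (graph P).Reachable J K) : J = K := by
  rw [SimpleGraph.reachable_iff_reflTransGen] at hr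
  rcases Relation.ReflTransGen.cases_head hr with h' | ⟨L, hL, _⟩
  · exact h'
  · exact absurd hL (h L)

section Component

variable {C : (graph P).ConnectedComponent}

theorem reachable_of_mem_supp {J K : ConnIdeal P} (hJ : J ∈ C.supp) (hK : K ∈ C.supp) :
    (graph P).Reachable J K := by
  rw [SimpleGraph.ConnectedComponent.mem_supp_iff] at hJ hK
  exact SimpleGraph.ConnectedComponent.exact (hJ.trans hK.symm)

theorem mem_supp_of_adj {J K : ConnIdeal P} (hJ : J ∈ C.supp) (h : (graph P).Adj J K) :
    K ∈ C.supp :=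
  C.mem_supp_of_adj_mem_supp hJ h

theorem supp_induction {J : ConnIdeal P} (hJ : J ∈ C.supp) {p : ConnIdeal P → Prop} (hp : p J)
    (step : ∀ A ∈ C.supp, ∀ B ∈ C.supp, (graph P).Adj A B → p A → p B) :
    ∀ K ∈ C.supp, p K := by
  intro K hK
  have hr := reachable_of_mem_supp hJ hK
  rw [SimpleGraph.reachable_iff_reflTransGen] at hr
  suffices H : K ∈ C.supp ∧ p K from H.2
  clear hK
  induction hr with
  | refl => exact ⟨hJ, hp⟩
  | tail _ h ih =>
    have hB := mem_supp_of_adj ih.1 h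
    exact ⟨hB, step _ ih.1 _ hB h ih.2⟩

theorem not_isolated_of_mem_supp {J K : ConnIdeal P} (hJ : J ∈ C.supp) (hK : K ∈ C.supp)
    (h : ¬ Isolated J) : ¬ Isolated K := by
  intro hiso
  exact h ((hiso.eq_of_reachable (reachable_of_mem_supp hK hJ)) ▸ hiso)

/-- A connected ideal outside a component that contains one of its members contains them all. -/
theorem subset_of_not_mem_supp {J K : ConnIdeal P} (hJ : J ∈ C.supp) (hK : K ∉ C.supp)
    (hJK : J.1 ⊆ K.1) : ∀ L ∈ C.supp, L.1 ⊆ K.1 := by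
  -- The neighbour `B` meets `A`, hence `K`, without being adjacent to `K`, so the two are nested;
  -- `K ⊆ B` would put `A` inside `B`.
  refine supp_induction hJ hJK fun A hA B hB hAB hAK => ?_
  obtain ⟨x, hx⟩ := hAB.1
  rw [Finset.mem_inter] at hx
  rcases subset_or_subset_of_not_adj (A := B) (B := K) (fun h => hK (mem_supp_of_adj hB h))
    ⟨x, Finset.mem_inter.mpr ⟨hx.2, hAK hx.1⟩⟩ with h | h
  · exact h
  · exact absurd (hAK.trans h) hAB.2.1

/-- The union of the members of a component is a connected order ideal. -/
theorem exists_supp_union (C : (graph P).ConnectedComponent) :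
    ∃ U : ConnIdeal P, ∀ x, x ∈ U.1 ↔ ∃ J ∈ C.supp, x ∈ J.1 := by
  classical
  obtain ⟨J₀, hJ₀⟩ := C.nonempty_supp
  have hmem : ∀ x, x ∈ (Finset.univ.filter fun x => ∃ J ∈ C.supp, x ∈ J.1) ↔
      ∃ J ∈ C.supp, x ∈ J.1 := by simp
  refine ⟨ConnIdeal.ofCompConnected (Finset.univ.filter fun x => ∃ J ∈ C.supp, x ∈ J.1)
    ?_ ⟨?_, ?_⟩, hmem⟩
  · intro i j hi hji
    rw [hmem] at hi ⊢
    obtain ⟨J, hJ, hiJ⟩ := hi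
    exact ⟨J, hJ, J.isOrderIdeal i j hiJ hji⟩
  · obtain ⟨x, hx⟩ := J₀.nonempty
    exact ⟨x, (hmem x).mpr ⟨J₀, hJ₀, hx⟩⟩
  · rintro A hA ⟨a, ha⟩ hcl
    have step : ∀ J ∈ C.supp, ∀ y ∈ J.1, y ∈ A → J.1 ⊆ A := by
      intro J hJ y hy hyA
      refine (J.compConnected.2 (A ∩ J.1) Finset.inter_subset_right
        ⟨y, Finset.mem_inter.mpr ⟨hyA, hy⟩⟩ ?_).trans Finset.inter_subset_left
      intro u hu v hv huv
      exact Finset.mem_inter.mpr ⟨hcl u (Finset.mem_inter.mp hu).1 v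
        ((hmem v).mpr ⟨J, hJ, hv⟩) huv, hv⟩
    obtain ⟨J, hJ, haJ⟩ := (hmem a).mp (hA ha)
    -- The members need not share a common point; the closed set `A` spreads along edges of `G_P`,
    -- whose ends meet.
    have hall := supp_induction (p := fun K => K.1 ⊆ A) hJ (step J hJ a haJ ha)
      fun K _ L hL hKL hKA => by
        obtain ⟨x, hx⟩ := hKL.1
        rw [Finset.mem_inter] at hx
        exact step L hL x hx.2 (hKA hx.1)
    intro b hb
    obtain ⟨K, hK, hbK⟩ := (hmem b).mp hb
    exact hall K hK hbK

/-- The union of the members of a connected component of `G_P`. -/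
noncomputable def suppUnion (C : (graph P).ConnectedComponent) : ConnIdeal P :=
  (exists_supp_union C).choose

theorem mem_suppUnion {x : Fin n} : x ∈ (suppUnion C).1 ↔ ∃ J ∈ C.supp, x ∈ J.1 :=
  (exists_supp_union C).choose_spec x

theorem subset_suppUnion {J : ConnIdeal P} (hJ : J ∈ C.supp) : J.1 ⊆ (suppUnion C).1 :=
  fun _ hx => mem_suppUnion.mpr ⟨J, hJ, hx⟩

theorem suppUnion_subset {J K : ConnIdeal P} (hJ : J ∈ C.supp) (hK : K ∉ C.supp)
    (hJK : J.1 ⊆ K.1) : (suppUnion C).1 ⊆ K.1 := by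
  intro x hx
  obtain ⟨L, hL, hxL⟩ := mem_suppUnion.mp hx
  exact subset_of_not_mem_supp hJ hK hJK L hL hxL

/-- An ideal outside `C` that meets the union meets a member `J` and is nested with it: if it
contains `J` it contains the whole union, otherwise it lies inside the union. Members of `C` lie
inside the union anyway. -/
theorem isolated_suppUnion (C : (graph P).ConnectedComponent) : Isolated (suppUnion C) := by
  intro K hadj
  obtain ⟨x, hx⟩ := hadj.1
  rw [Finset.mem_inter] at hx
  obtain ⟨J, hJ, hxJ⟩ := mem_suppUnion.mp hx.1
  by_cases hK : K ∈ C.supp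
  · exact hadj.2.2 (subset_suppUnion hK)
  · rcases subset_or_subset_of_not_adj (A := J) (B := K) (fun h => hK (mem_supp_of_adj hJ h))
      ⟨x, Finset.mem_inter.mpr ⟨hxJ, hx.2⟩⟩ with h | h
    · exact hadj.2.1 (suppUnion_subset hJ hK h)
    · exact hadj.2.2 (h.trans (subset_suppUnion hJ))

theorem Isolated.mem {J : ConnIdeal P} (h : Isolated J) {M : Finset (ConnIdeal P)}
    (hM : (graph P).IsMaximumIndepSet M) : J ∈ M := by
  classical
  by_contra hJ
  have hind : (graph P).IsIndepSet ((insert J M : Finset (ConnIdeal P)) : Set (ConnIdeal P)) := by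
    intro A hA B hB hne hadj
    simp only [Finset.coe_insert, Set.mem_insert_iff, Finset.mem_coe] at hA hB
    rcases hA with rfl | hA
    · exact h B hadj
    · rcases hB with rfl | hB
      · exact h A hadj.symm
      · exact hM.isIndepSet hA hB hne hadj
  have := hM.maximum _ hind
  rw [Finset.card_insert_of_notMem hJ] at this
  omega

/-- A member `K` of `M` strictly inside `J` is kept in `M'` if it lies in `C` or is isolated.
Otherwise it is replaced by the union of its own component, which is isolated, hence in `M'`, and
still strictly inside `J`. Non-isolation of `J₀` ensures that `suppUnion C` is not itself a vertex
of `C`. -/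
theorem mu_subset_mu {J₀ J : ConnIdeal P} (hJ₀ : J₀ ∈ C.supp) (hiso : ¬ Isolated J₀)
    (hJ : J ∈ C.supp ∨ J = suppUnion C) {M M' : Finset (ConnIdeal P)}
    (hM' : (graph P).IsMaximumIndepSet M')
    (hMM' : ∀ K ∈ C.supp, K ∈ M → K ∈ M') : mu M J ⊆ mu M' J := by
  intro x hx
  obtain ⟨K, hK, hKJ, hxK⟩ := mem_mu.mp hx
  by_cases hKC : K ∈ C.supp
  · exact mem_mu.mpr ⟨K, hMM' K hKC hK, hKJ, hxK⟩
  by_cases hKI : Isolated K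
  · exact mem_mu.mpr ⟨K, hKI.mem hM', hKJ, hxK⟩
  set D := (graph P).connectedComponentMk K with hD
  have hKD : K ∈ D.supp := SimpleGraph.ConnectedComponent.connectedComponentMk_mem
  have hCD : ∀ L ∈ C.supp, L ∉ D.supp := by
    intro L hL hLD
    rw [SimpleGraph.ConnectedComponent.mem_supp_iff] at hL hLD hKC
    exact hKC (by rw [← hL, hLD])
  have hJD : J ∉ D.supp := by
    rcases hJ with hJ | rfl
    · exact hCD J hJ
    · exact fun h => not_isolated_of_mem_supp hKD h hKI (isolated_suppUnion C)
  have hne : suppUnion D ≠ J := by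
    intro heq
    rcases hJ with hJ | rfl
    · exact not_isolated_of_mem_supp hJ₀ hJ hiso (heq ▸ isolated_suppUnion D)
    · obtain ⟨L, hL, hxL⟩ := mem_suppUnion.mp (hKJ.1 hxK)
      rcases subset_or_subset_of_not_adj (A := L) (B := K) (fun h => hKC (mem_supp_of_adj hL h))
        ⟨x, Finset.mem_inter.mpr ⟨hxL, hxK⟩⟩ with h | h
      · exact hKJ.2 (suppUnion_subset hL hKC h)
      · have h1 := suppUnion_subset hKD (hCD L hL) h
        rw [heq] at h1
        have h2 : suppUnion C = L :=
          ConnIdeal.ext' (Finset.Subset.antisymm h1 (subset_suppUnion hL))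
        exact not_isolated_of_mem_supp hJ₀ hL hiso (h2 ▸ isolated_suppUnion C)
  exact mem_mu.mpr ⟨suppUnion D, (isolated_suppUnion D).mem hM',
    ConnIdeal.ssubset_of_subset_of_ne (suppUnion_subset hKD hJD hKJ.1) hne,
    subset_suppUnion hKD hxK⟩

end Component

/-! ### Locality of descents -/

/-- An isolated vertex of `G_P` is never a descent ideal. -/
theorem Labeled.label_not_lt_of_isolated {M : Finset (ConnIdeal P)} {l : ConnIdeal P → Fin n}
    {t : Fin n → ConnIdeal P} (hP : NaturallyLabeled P) (h : Labeled M l t) {J K : ConnIdeal P}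
    (hJ : J ∈ M) (hK : K ∈ M) (hiso : Isolated J) (hJK : J.1 ⊂ K.1)
    (hcov : ∀ L ∈ M, J.1 ⊂ L.1 → ¬ L.1 ⊂ K.1) : ¬ l K < l J := by
  obtain ⟨y, hy, x, hx, hxJ, hyx⟩ :=
    ConnIdeal.exists_lt_of_ssubset J.nonempty J.isOrderIdeal hJK
  -- Otherwise `x` lies in a member strictly inside `K`; it contains `y`, so it lies strictly
  -- between `J` and `K`.
  have hxl : x = l K := by
    by_contra hne
    have hmu : x ∈ mu M K := by
      by_contra hmu
      have : x ∈ K.1 \ mu M K := Finset.mem_sdiff.mpr ⟨hx, hmu⟩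
      rw [h.sdiff_mu K hK, Finset.mem_singleton] at this
      exact hne this
    obtain ⟨L, hL, hLK, hxL⟩ := mem_mu.mp hmu
    rcases subset_or_ssubset_of_mem h.indep hL hJ (L.isOrderIdeal x y hxL hyx.le) hy with h1 | h1
    · exact hxJ (h1 hxL)
    · exact hcov L hL h1 hLK
  -- The principal ideal of `x` meets the isolated `J` and is not inside it, so it contains `J`.
  -- Then `l J` is below `x = l K` in `P`, and natural labeling compares the labels.
  obtain ⟨Q, hQ⟩ := ConnIdeal.exists_principal P x
  have hxQ : x ∈ Q.1 := (hQ x).mpr (P.le_refl x)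
  rcases subset_or_subset_of_not_adj (hiso Q)
    ⟨y, Finset.mem_inter.mpr ⟨hy, (hQ y).mpr hyx.le⟩⟩ with h1 | h1
  · have h2 : P.le (l J) x := (hQ _).mp (h1 (h.label_mem hJ))
    have hne : l J ≠ x := fun h' => hxJ (h' ▸ h.label_mem hJ)
    have h3 := hP _ _ ((@lt_iff_le_and_ne _ P (l J) x).mpr ⟨h2, hne⟩)
    rw [← hxl]
    exact Nat.lt_asymm h3
  · exact absurd (h1 hxQ) hxJ

theorem Extends.mem_iff {C : (graph P).ConnectedComponent} {Mr M : Finset (ConnIdeal P)}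
    (h : Extends C Mr M) {J : ConnIdeal P} : J ∈ Mr ↔ J ∈ M ∧ J ∈ C.supp := by
  have := Set.ext_iff.mp h.2 J
  simpa using this.symm

/-- A descent ideal `J` is not isolated, and its parent lies in `C` or is `suppUnion C`. On these
ideals `M` and `M'` have the same members and the same labels, so the descent persists. Exchanging
`M` and `M'` gives equality. -/
theorem Extends.desBarRel_subset {C : (graph P).ConnectedComponent} (hP : NaturallyLabeled P)
    {Mr M M' : Finset (ConnIdeal P)} (h : Extends C Mr M) (h' : Extends C Mr M') :
    desBarRel Mr M ⊆ desBarRel Mr M' := by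
  obtain ⟨l, t, hl⟩ := exists_labeled h.1.isIndepSet ((isMaximumIndepSet_iff_card hP).mp h.1).2
  obtain ⟨l', t', hl'⟩ :=
    exists_labeled h'.1.isIndepSet ((isMaximumIndepSet_iff_card hP).mp h'.1).2
  intro J hJ
  rw [hl.mem_desBarRel_iff (fun K hK => (h.mem_iff.mp hK).1)] at hJ
  rw [hl'.mem_desBarRel_iff (fun K hK => (h'.mem_iff.mp hK).1)]
  obtain ⟨hJr, K, hK, hJK, hlt, hcov⟩ := hJ
  obtain ⟨hJM, hJC⟩ := h.mem_iff.mp hJr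
  have hJM' := (h'.mem_iff.mp hJr).1
  have hiso : ¬ Isolated J := fun hiso =>
    hl.label_not_lt_of_isolated hP hJM hK hiso hJK hcov hlt
  have hMM' : ∀ L ∈ C.supp, L ∈ M → L ∈ M' :=
    fun L hL hLM => (h'.mem_iff.mp (h.mem_iff.mpr ⟨hLM, hL⟩)).1
  have hM'M : ∀ L ∈ C.supp, L ∈ M' → L ∈ M :=
    fun L hL hLM => (h.mem_iff.mp (h'.mem_iff.mpr ⟨hLM, hL⟩)).1
  have hlab : ∀ L, (L ∈ C.supp ∨ L = suppUnion C) → L ∈ M → L ∈ M' → l L = l' L := by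
    intro L hL hLM hLM'
    have h1 : mu M L = mu M' L := Finset.Subset.antisymm
      (mu_subset_mu hJC hiso hL h'.1 hMM') (mu_subset_mu hJC hiso hL h.1 hM'M)
    have h2 := hl.sdiff_mu L hLM
    rw [h1, hl'.sdiff_mu L hLM', Finset.singleton_inj] at h2
    exact h2.symm
  have hUne : J ≠ suppUnion C := fun heq => hiso (heq ▸ isolated_suppUnion C)
  -- A parent outside `C` contains `suppUnion C`, a member of `M` strictly above `J`, and so equals
  -- it.
  have hKC : K ∈ C.supp ∨ K = suppUnion C := by
    by_cases hKC : K ∈ C.supp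
    · exact Or.inl hKC
    · right
      by_contra hne
      exact hcov (suppUnion C) ((isolated_suppUnion C).mem h.1)
        (ConnIdeal.ssubset_of_subset_of_ne (subset_suppUnion hJC) hUne)
        (ConnIdeal.ssubset_of_subset_of_ne (suppUnion_subset hJC hKC hJK.1) (Ne.symm hne))
  have hKM' : K ∈ M' := by
    rcases hKC with hKC | rfl
    · exact hMM' K hKC hK
    · exact (isolated_suppUnion C).mem h'.1
  have hKU : K.1 ⊆ (suppUnion C).1 := by
    rcases hKC with hKC | rfl
    · exact subset_suppUnion hKC
    · exact Finset.Subset.refl _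
  refine ⟨hJr, K, hKM', hJK, ?_, ?_⟩
  · rwa [← hlab K hKC hK hKM', ← hlab J (Or.inl hJC) hJM hJM']
  · intro L hL hJL hLK
    by_cases hLC : L ∈ C.supp
    · exact hcov L (hM'M L hLC hL) hJL hLK
    · exact hLK.2 (hKU.trans (suppUnion_subset hJC hLC hJL.1))

theorem Extends.desBarRel_eq_desBar {C : (graph P).ConnectedComponent} (hP : NaturallyLabeled P)
    {Mr M : Finset (ConnIdeal P)} (h : Extends C Mr M) : desBarRel Mr M = desBar C Mr := by
  have hex : ∃ M, Extends C Mr M := ⟨M, h⟩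
  rw [desBar, dif_pos hex]
  exact Finset.Subset.antisymm (h.desBarRel_subset hP hex.choose_spec)
    (hex.choose_spec.desBarRel_subset hP h)


/-! ### Factorisation over the components -/

theorem mem_compMaxIndepSets {C : (graph P).ConnectedComponent} {N : Finset (ConnIdeal P)} :
    N ∈ compMaxIndepSets C ↔ (∀ J ∈ N, J ∈ C.supp) ∧ (graph P).IsIndepSet (N : Set (ConnIdeal P)) ∧
      ∀ N' : Finset (ConnIdeal P), (∀ J ∈ N', J ∈ C.supp) →
        (graph P).IsIndepSet (N' : Set (ConnIdeal P)) → N'.card ≤ N.card := by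
  classical
  have hmap : ∀ L : Finset C, C.toSimpleGraph.IsIndepSet (L : Set C) ↔ (graph P).IsIndepSet
      ((L.map (Function.Embedding.subtype _) : Finset (ConnIdeal P)) : Set (ConnIdeal P)) := by
    intro L
    constructor
    · intro h A hA B hB hne
      simp only [Finset.coe_map, Set.mem_image, Finset.mem_coe] at hA hB
      obtain ⟨A, hA, rfl⟩ := hA
      obtain ⟨B, hB, rfl⟩ := hB
      exact h hA hB fun h' => hne (by rw [h'])
    · intro h A hA B hB hne
      exact h (Finset.mem_map_of_mem _ hA) (Finset.mem_map_of_mem _ hB)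
        fun h' => hne (Subtype.ext h')
  have hlift : ∀ N' : Finset (ConnIdeal P), (∀ J ∈ N', J ∈ C.supp) →
      ∃ L : Finset C, N' = L.map (Function.Embedding.subtype _) := by
    intro N' hN'
    refine ⟨N'.subtype (fun J => J ∈ C), ?_⟩
    rw [Finset.subtype_map_of_mem]
    exact hN'
  rw [compMaxIndepSets, Finset.mem_filter]
  simp only [Finset.mem_univ, true_and]
  constructor
  · rintro ⟨L, hL, rfl⟩
    refine ⟨?_, (hmap L).mp hL.isIndepSet, ?_⟩
    · intro J hJ
      obtain ⟨⟨J, h⟩, -, rfl⟩ := Finset.mem_map.mp hJ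
      exact h
    · intro N' hN' hind
      obtain ⟨L', rfl⟩ := hlift N' hN'
      rw [Finset.card_map, Finset.card_map]
      exact hL.maximum L' ((hmap L').mpr hind)
  · rintro ⟨h1, h2, h3⟩
    obtain ⟨L, rfl⟩ := hlift N h1
    refine ⟨L, ⟨(hmap L).mpr h2, fun L' hL' => ?_⟩, rfl⟩
    have := h3 (L'.map (Function.Embedding.subtype _)) (fun J hJ => by
      obtain ⟨⟨J, h⟩, -, rfl⟩ := Finset.mem_map.mp hJ
      exact h) ((hmap L').mp hL')
    rwa [Finset.card_map, Finset.card_map] at this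

theorem mem_supp_iff_mk {C : (graph P).ConnectedComponent} {J : ConnIdeal P} :
    J ∈ C.supp ↔ (graph P).connectedComponentMk J = C := Iff.rfl

open scoped Classical in
/-- The part of a set of vertices of `G_P` in a connected component. -/
noncomputable def restrict (M : Finset (ConnIdeal P)) (C : (graph P).ConnectedComponent) :
    Finset (ConnIdeal P) :=
  M.filter fun J => (graph P).connectedComponentMk J = C

theorem mem_restrict {M : Finset (ConnIdeal P)} {C : (graph P).ConnectedComponent}
    {J : ConnIdeal P} : J ∈ restrict M C ↔ J ∈ M ∧ J ∈ C.supp := by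
  classical
  exact Finset.mem_filter

open scoped Classical in
/-- The union of a family of vertex sets indexed by the connected components. -/
noncomputable def glue (p : (graph P).ConnectedComponent → Finset (ConnIdeal P)) :
    Finset (ConnIdeal P) :=
  Finset.univ.biUnion p

theorem mem_glue {p : (graph P).ConnectedComponent → Finset (ConnIdeal P)}
    (hp : ∀ C, ∀ J ∈ p C, J ∈ C.supp) {J : ConnIdeal P} {C : (graph P).ConnectedComponent}
    (hJ : J ∈ C.supp) : J ∈ glue p ↔ J ∈ p C := by
  classical
  simp only [glue, Finset.mem_biUnion, Finset.mem_univ, true_and]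
  constructor
  · rintro ⟨D, hD⟩
    have := hp D J hD
    rw [mem_supp_iff_mk] at this hJ
    rw [← hJ, this]
    exact hD
  · exact fun h => ⟨C, h⟩

theorem restrict_glue {p : (graph P).ConnectedComponent → Finset (ConnIdeal P)}
    (hp : ∀ C, ∀ J ∈ p C, J ∈ C.supp) (C : (graph P).ConnectedComponent) :
    restrict (glue p) C = p C := by
  ext J
  rw [mem_restrict]
  exact ⟨fun h => (mem_glue hp h.2).mp h.1, fun h => ⟨(mem_glue hp (hp C J h)).mpr h, hp C J h⟩⟩

theorem glue_restrict (M : Finset (ConnIdeal P)) : glue (restrict M) = M := by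
  ext J
  have hJ : J ∈ ((graph P).connectedComponentMk J).supp := rfl
  rw [mem_glue (fun C K hK => (mem_restrict.mp hK).2) hJ, mem_restrict]
  exact ⟨fun h => h.1, fun h => ⟨h, hJ⟩⟩

theorem card_eq_sum_restrict (M : Finset (ConnIdeal P)) :
    M.card = ∑ C, (restrict M C).card := by
  classical
  exact Finset.card_eq_sum_card_fiberwise (fun J _ => Finset.mem_univ _)

theorem isIndepSet_glue {p : (graph P).ConnectedComponent → Finset (ConnIdeal P)}
    (hp : ∀ C, ∀ J ∈ p C, J ∈ C.supp)
    (hind : ∀ C, (graph P).IsIndepSet (p C : Set (ConnIdeal P))) :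
    (graph P).IsIndepSet (glue p : Set (ConnIdeal P)) := by
  intro A hA B hB hne hadj
  have hAC : A ∈ ((graph P).connectedComponentMk A).supp := rfl
  have hBC := mem_supp_of_adj hAC hadj
  exact hind _ ((mem_glue hp hAC).mp hA) ((mem_glue hp hBC).mp hB) hne hadj

theorem isIndepSet_restrict {M : Finset (ConnIdeal P)}
    (h : (graph P).IsIndepSet (M : Set (ConnIdeal P))) (C : (graph P).ConnectedComponent) :
    (graph P).IsIndepSet (restrict M C : Set (ConnIdeal P)) :=
  fun _ hA _ hB => h (mem_restrict.mp hA).1 (mem_restrict.mp hB).1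

/-- Maximum independent sets of the components glue to a maximum independent set of `G_P`. -/
theorem isMaximumIndepSet_glue {p : (graph P).ConnectedComponent → Finset (ConnIdeal P)}
    (hp : ∀ C, p C ∈ compMaxIndepSets C) : (graph P).IsMaximumIndepSet (glue p) := by
  have hp' : ∀ C, ∀ J ∈ p C, J ∈ C.supp := fun C => (mem_compMaxIndepSets.mp (hp C)).1
  refine ⟨isIndepSet_glue hp' fun C => (mem_compMaxIndepSets.mp (hp C)).2.1, fun N hN => ?_⟩
  rw [card_eq_sum_restrict N, card_eq_sum_restrict (glue p)]
  refine Finset.sum_le_sum fun C _ => ?_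
  rw [restrict_glue hp']
  exact (mem_compMaxIndepSets.mp (hp C)).2.2 _ (fun J hJ => (mem_restrict.mp hJ).2)
    (isIndepSet_restrict hN C)

/-- Exchange argument: replacing the part of `M` in `C` by a competitor `N` keeps independence, and
every other component contributes the same cardinality, so `N` cannot be larger. -/
theorem restrict_mem_compMaxIndepSets {M : Finset (ConnIdeal P)}
    (hM : (graph P).IsMaximumIndepSet M) (C : (graph P).ConnectedComponent) :
    restrict M C ∈ compMaxIndepSets C := by
  classical
  refine mem_compMaxIndepSets.mpr ⟨fun J hJ => (mem_restrict.mp hJ).2,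
    isIndepSet_restrict hM.isIndepSet C, fun N hN hind => ?_⟩
  set p := Function.update (restrict M) C N with hpdef
  have hp : ∀ D, ∀ J ∈ p D, J ∈ D.supp := by
    intro D J hJ
    by_cases hD : D = C
    · subst hD
      rw [hpdef, Function.update_self] at hJ
      exact hN J hJ
    · rw [hpdef, Function.update_of_ne hD] at hJ
      exact (mem_restrict.mp hJ).2
  have hpi : ∀ D, (graph P).IsIndepSet (p D : Set (ConnIdeal P)) := by
    intro D
    by_cases hD : D = C
    · subst hD
      rw [hpdef, Function.update_self]
      exact hind
    · rw [hpdef, Function.update_of_ne hD]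
      exact isIndepSet_restrict hM.isIndepSet D
  have hle := hM.maximum _ (isIndepSet_glue hp hpi)
  rw [card_eq_sum_restrict M, card_eq_sum_restrict (glue p),
    ← Finset.add_sum_erase _ _ (Finset.mem_univ C),
    ← Finset.add_sum_erase _ _ (Finset.mem_univ C), restrict_glue hp] at hle
  have hrest : ∑ D ∈ Finset.univ.erase C, (restrict (glue p) D).card =
      ∑ D ∈ Finset.univ.erase C, (restrict M D).card := by
    refine Finset.sum_congr rfl fun D hD => ?_
    rw [restrict_glue hp, hpdef, Function.update_of_ne (Finset.ne_of_mem_erase hD)]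
  rw [hrest, hpdef, Function.update_self] at hle
  omega

theorem extends_iff {C : (graph P).ConnectedComponent} {Mr M : Finset (ConnIdeal P)} :
    Extends C Mr M ↔ (graph P).IsMaximumIndepSet M ∧ restrict M C = Mr := by
  refine and_congr_right fun _ => ?_
  rw [← Finset.coe_inj]
  have : (restrict M C : Set (ConnIdeal P)) = (M : Set (ConnIdeal P)) ∩ C.supp := by
    ext J
    exact mem_restrict
  rw [this]

theorem exists_extends {C : (graph P).ConnectedComponent} {Mr : Finset (ConnIdeal P)}
    (h : Mr ∈ compMaxIndepSets C) : ∃ M, Extends C Mr M := by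
  classical
  obtain ⟨M₀, hM₀⟩ := (graph P).maximumIndepSet_exists
  have hp : ∀ D, Function.update (restrict M₀) C Mr D ∈ compMaxIndepSets D := by
    intro D
    by_cases hD : D = C
    · subst hD
      rwa [Function.update_self]
    · rw [Function.update_of_ne hD]
      exact restrict_mem_compMaxIndepSets hM₀ D
  refine ⟨_, extends_iff.mpr ⟨isMaximumIndepSet_glue hp, ?_⟩⟩
  rw [restrict_glue fun D => (mem_compMaxIndepSets.mp (hp D)).1, Function.update_self]

theorem prod_restrict {R : Type*} [CommMonoid R] (N : Finset (ConnIdeal P))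
    (g : ConnIdeal P → R) : ∏ C, ∏ J ∈ restrict N C, g J = ∏ J ∈ N, g J := by
  classical
  exact Finset.prod_fiberwise N (fun J => (graph P).connectedComponentMk J) g

theorem desBarRel_restrict (M : Finset (ConnIdeal P)) (C : (graph P).ConnectedComponent) :
    desBarRel (restrict M C) M = restrict (desBarRel M M) C := by
  classical
  ext J
  rw [mem_restrict, desBarRel, desBarRel, Finset.mem_filter, Finset.mem_filter, mem_restrict]
  constructor
  · rintro ⟨⟨hJ, hC⟩, i, ⟨hi, -⟩, hJi⟩
    exact ⟨⟨hJ, i, ⟨hi, J, hJ, hJi.symm⟩, hJi⟩, hC⟩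
  · rintro ⟨⟨hJ, i, ⟨hi, -⟩, hJi⟩, hC⟩
    exact ⟨⟨hJ, hC⟩, i, ⟨hi, J, mem_restrict.mpr ⟨hJ, hC⟩, hJi.symm⟩, hJi⟩

-- The expanded product is a sum over choices of one $M_r$ per component; `restrict` and `glue`
-- match these with the maximum independent sets of $G_P$, and by locality the descents split
-- accordingly.
open scoped Classical in
theorem sum_isMaximumIndepSet_eq_prod (hP : NaturallyLabeled P) :
    ∑ M : Finset (ConnIdeal P) with (graph P).IsMaximumIndepSet M,
      (∏ J ∈ desBarRel M M, mono J) * ∏ J ∈ M, (1 - mono J)⁻¹ =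
    ∏ C : (graph P).ConnectedComponent, ∑ Mr ∈ compMaxIndepSets C,
      (∏ J ∈ desBar C Mr, mono J) * ∏ J ∈ Mr, (1 - mono J)⁻¹ := by
  rw [Finset.prod_univ_sum]
  refine Finset.sum_bij' (fun M _ => restrict M) (fun p _ => glue p) ?_ ?_ ?_ ?_ ?_
  · intro M hM
    exact Fintype.mem_piFinset.mpr
      (restrict_mem_compMaxIndepSets (Finset.mem_filter.mp hM).2)
  · intro p hp
    exact Finset.mem_filter.mpr ⟨Finset.mem_univ _,
      isMaximumIndepSet_glue (Fintype.mem_piFinset.mp hp)⟩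
  · intro M _
    exact glue_restrict M
  · intro p hp
    funext C
    exact restrict_glue
      (fun C => (mem_compMaxIndepSets.mp (Fintype.mem_piFinset.mp hp C)).1) C
  · intro M hM
    have hdes : ∀ C, desBar C (restrict M C) = restrict (desBarRel M M) C := by
      intro C
      have hext : Extends C (restrict M C) M :=
        extends_iff.mpr ⟨(Finset.mem_filter.mp hM).2, rfl⟩
      rw [← hext.desBarRel_eq_desBar hP, desBarRel_restrict]
    simp only [hdes]
    rw [Finset.prod_mul_distrib, prod_restrict, prod_restrict]

end PPart

theorem theorem1p3 (n : ℕ) (P : PartialOrder (Fin n)) (hP : PPart.NaturallyLabeled P) :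
    -- the descent ideals of `M_r` are well defined
    (∀ C : (PPart.graph P).ConnectedComponent, ∀ Mr ∈ PPart.compMaxIndepSets C,
      (∃ M, PPart.Extends C Mr M) ∧
      ∀ M, PPart.Extends C Mr M → PPart.desBarRel Mr M = PPart.desBar C Mr) ∧
    -- the product formula
    PPart.genFun P =
      ∏ C : (PPart.graph P).ConnectedComponent, ∑ Mr ∈ PPart.compMaxIndepSets C,
        (∏ J ∈ PPart.desBar C Mr, PPart.mono J) * ∏ J ∈ Mr, (1 - PPart.mono J)⁻¹ := by
  refine ⟨fun C Mr hMr => ⟨PPart.exists_extends hMr, fun M hM => hM.desBarRel_eq_desBar hP⟩, ?_⟩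
  rw [PPart.genFun_eq_sum hP, PPart.sum_isMaximumIndepSet_eq_prod hP]
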